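/- **Conventions.** Let $G$ be a group. A *$G$-tree* is a metric simplicial tree $T$ (a nonempty simplicial tree with positive edge lengths, bounded below near each vertex) with an isometric simplicial action of $G$ without inversions. Its vertices are the points $p$ such that $T\setminus p$ does not have exactly two components, together with the midpoints of arcs inverted by an element of $G$ (if $T$ is a line and there are no such points, any $G$-invariant subdivision into edges is allowed). $T$ is *minimal* if it contains no proper $G$-invariant subtree, *cocompact* if $T/G$ is compact, i.e. a finite graph, and *edge-free* if all edge stabilisers are trivial. A *representative tree* is the image $j(Y_0)\subseteq T$ of a lift $j:Y_0\to T$ of a maximal tree $Y_0$ of $T/G$. For edge-free $T$, the corresponding *quotient graph of groups* on $T/G$ has vertex group $\mathrm{stab}(j(x))$ at each vertex $x$ and trivial edge groups. A subgroup of $G$ is *elliptic* for $T$ if it fixes a point of $T$; $\mathcal G_T$ is the set of elliptic subgroups. A *free factor system* of $G$ is a set of the form $\mathcal G_T$ for a minimal, cocompact, edge-free $G$-tree $T$. A *traditional free factor system* is a set $\{[G_1],\dots,[G_k]\}$ of conjugacy classes of subgroups, where $k\ge 0$, each $G_i\le G$ is nontrivial and $G=G_1*\dots*G_k*F_r$ is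 an (internal) free product with $F_r$ free of some finite rank $r\ge 0$; for $k=0$, i.e. $G=F_r$, it is the empty set. **Theorem.** Let $k\ge 0$ and let $G_1,\dots,G_k$ be nontrivial subgroups of $G$. The following are equivalent: 1. there is a minimal, cocompact, edge-free $G$-tree $T$ with a representative tree $T_0$ such that the nontrivial vertex stabilisers in $T_0$ are exactly $G_1,\dots,G_k$ (one for each vertex of $T_0$ with nontrivial stabiliser); 2. there is a minimal, cocompact, edge-free $G$-tree $T$ and a quotient graph of groups on $T/G$ whose nontrivial vertex groups are exactly $G_1,\dots,G_k$ (one for each vertex with nontrivial vertex group); 3. $G=G_1*\dots*G_k*F_r$ for some free group $F_r$ of finite rank $r\ge 0$. **Corollary.** There is a bijection $\Phi$ from the free factor systems of $G$ to the traditional free factor systems of $G$ such that $\Phi$ and $\Phi^{-1}$ are given by the following constructions, which do not depend on the choices made: * given a free factor system $\mathcal G$, choose a minimal, cocompact, edge-free $G$-tree $T$ with $\mathcal G=\mathcal G_T$ and a representative tree $T_0$ in $T$; then $\Phi(\mathcal G)$ is the set of conjugacy classes of the nontrivial vertex stabilisers in $T_0$; * given a traditional free factor system $\mathcal C$, choose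 a decomposition $G=G_1*\dots*G_k*F_r$ with all $G_i$ nontrivial and $\mathcal C=\{[G_1],\dots,[G_k]\}$, and a minimal, cocompact, edge-free $G$-tree $T$ with a representative tree whose nontrivial vertex stabilisers are exactly $G_1,\dots,G_k$; then $\Phi^{-1}(\mathcal C)=\mathcal G_T$. -/

import Mathlib

universe u

/-! ### Serre graphs -/

/-- A graph in the sense of Serre: every geometric edge is a pair `e`, `bar e` of oriented edges. -/
structure SerreGraph where
  V : Type u
  E : Type u
  bar : E → E
  init : E → V
  bar_bar : ∀ e, bar (bar e) = e
  bar_ne : ∀ e, bar e ≠ e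

namespace SerreGraph

/-- The terminal vertex of an oriented edge. -/
def term (Y : SerreGraph.{u}) (e : Y.E) : Y.V := Y.init (Y.bar e)

/-- `Y.IsPath v l w`: the list of oriented edges `l` is an edge path from `v` to `w`. -/
def IsPath (Y : SerreGraph.{u}) : Y.V → List Y.E → Y.V → Prop
  | v, [], w => v = w
  | v, e :: l, w => Y.init e = v ∧ Y.IsPath (Y.term e) l w

/-- An edge path is reduced if it contains no backtracking `e, bar e`. -/
def IsReduced (Y : SerreGraph.{u}) (l : List Y.E) : Prop :=
  l.IsChain (fun e f => f ≠ Y.bar e)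

/-- Connected graphs (in particular nonempty). -/
def IsConnected (Y : SerreGraph.{u}) : Prop :=
  Nonempty Y.V ∧ ∀ v w, ∃ l, Y.IsPath v l w

/-- Trees: nonempty graphs in which any two vertices are joined by a unique reduced edge path. -/
def IsTree (Y : SerreGraph.{u}) : Prop :=
  Nonempty Y.V ∧ ∀ v w, ∃! l, Y.IsPath v l w ∧ Y.IsReduced l

/-- The set of geometric (unoriented) edges. -/
def GeomEdge (Y : SerreGraph.{u}) : Type u := Quot (fun e f : Y.E => f = Y.bar e)

/-- The geometric edge underlying an oriented edge. -/
def geom (Y : SerreGraph.{u}) (e : Y.E) : Y.GeomEdge := Quot.mk _ e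

/-- Morphisms of graphs. -/
structure Hom (X Y : SerreGraph.{u}) where
  onV : X.V → Y.V
  onE : X.E → Y.E
  onE_bar : ∀ e, onE (X.bar e) = Y.bar (onE e)
  onV_init : ∀ e, onV (X.init e) = Y.init (onE e)

theorem Hom.isPath {X Y : SerreGraph.{u}} (f : Hom X Y) :
    ∀ (v : X.V) (l : List X.E) (w : X.V), X.IsPath v l w →
      Y.IsPath (f.onV v) (l.map f.onE) (f.onV w)
  | _, [], _, h => congrArg f.onV h
  | v, e :: l, w, h => by
      refine ⟨by rw [← f.onV_init, h.1], ?_⟩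
      have := f.isPath _ l w h.2
      rwa [term, f.onV_init, f.onE_bar] at this

/-- Subgraphs (subforests, when the ambient graph is a tree). -/
@[ext] structure Subgraph (Y : SerreGraph.{u}) where
  verts : Set Y.V
  edges : Set Y.E
  bar_mem : ∀ e ∈ edges, Y.bar e ∈ edges
  init_mem : ∀ e ∈ edges, Y.init e ∈ verts

/-- A subgraph, as a graph. -/
def Subgraph.toGraph {Y : SerreGraph.{u}} (S : Subgraph Y) : SerreGraph.{u} where
  V := S.verts
  E := S.edges
  bar e := ⟨Y.bar e.1, S.bar_mem _ e.2⟩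
  init e := ⟨Y.init e.1, S.init_mem _ e.2⟩
  bar_bar e := Subtype.ext (Y.bar_bar e.1)
  bar_ne e h := Y.bar_ne e.1 (congrArg Subtype.val h)

/-- The image of a morphism of graphs. -/
def Hom.range {X Y : SerreGraph.{u}} (f : Hom X Y) : Subgraph Y where
  verts := Set.range f.onV
  edges := Set.range f.onE
  bar_mem := by
    rintro _ ⟨e, rfl⟩
    exact ⟨X.bar e, f.onE_bar e⟩
  init_mem := by
    rintro _ ⟨e, rfl⟩
    exact ⟨X.init e, f.onV_init e⟩

end SerreGraph

/-! ### Graphs of groups -/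

/-- A metric graph of groups. Edge groups are indexed by geometric edges, so that the groups
attached to `e` and `bar e` are the same group; `ρ e` embeds it in the group at the terminal
vertex of `e`. -/
structure MetricGraphOfGroups where
  graph : SerreGraph.{u}
  connected : graph.IsConnected
  len : graph.E → ℝ
  len_pos : ∀ e, 0 < len e
  len_bar : ∀ e, len (graph.bar e) = len e
  vertexGroup : graph.V → Type u
  [vertexGroup_group : ∀ v, Group (vertexGroup v)]
  edgeGroup : graph.GeomEdge → Type u
  [edgeGroup_group : ∀ e, Group (edgeGroup e)]
  ρ : ∀ e : graph.E, edgeGroup (graph.geom e) →* vertexGroup (graph.term e)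
  ρ_injective : ∀ e, Function.Injective (ρ e)

/-! ### `G`-trees -/

/-- A metric simplicial tree with an isometric action of `G` without inversions, presented as a
metric graph: a tree, a `G`-invariant length for every edge (bounded below at every vertex), and an
action by graph automorphisms. A right action `x · g` is turned into the left action
`g • x = x · g⁻¹`, which has the same stabilisers, orbits and invariant subtrees. -/
structure GTree (G : Type u) [Group G] extends SerreGraph.{u} where
  isTree : toSerreGraph.IsTree
  len : E → ℝ
  len_pos : ∀ e, 0 < len e
  len_bar : ∀ e, len (bar e) = len e
  len_bdd : ∀ v, ∃ ε : ℝ, 0 < ε ∧ ∀ e, init e = v → ε ≤ len e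
  [actV : MulAction G V]
  [actE : MulAction G E]
  smul_bar : ∀ (g : G) (e : E), g • bar e = bar (g • e)
  smul_init : ∀ (g : G) (e : E), g • init e = init (g • e)
  len_smul : ∀ (g : G) (e : E), len (g • e) = len e
  no_inversion : ∀ (g : G) (e : E), g • e ≠ bar e

attribute [instance] GTree.actV GTree.actE

namespace GTree

variable {G : Type u} [Group G]

/-- `T` contains no proper `G`-invariant subtree. -/
def IsMinimal (T : GTree G) : Prop :=
  ∀ S : SerreGraph.Subgraph T.toSerreGraph, S.toGraph.IsConnected →
    (∀ (g : G), ∀ v ∈ S.verts, g • v ∈ S.verts) → (∀ (g : G), ∀ e ∈ S.edges, g • e ∈ S.edges) →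
    S.verts = Set.univ ∧ S.edges = Set.univ

/-- Every edge has trivial stabiliser (the stabiliser may reverse the edge). -/
def IsEdgeFree (T : GTree G) : Prop :=
  ∀ (e : T.E) (g : G), (g • e = e ∨ g • e = T.bar e) → g = 1

/-- A vertex of degree two whose stabiliser does not interchange its two edges; that is, a regular
point of `T` which is not the midpoint of an arc inverted by an element of `G`. -/
def IsSuperfluous (T : GTree G) (v : T.V) : Prop :=
  {e : T.E | T.init e = v}.encard = 2 ∧ ∀ g : G, g • v = v → ∀ e, T.init e = v → g • e = e

/-- The simplicial structure is the standard one: the vertices are the non-regular points of `T`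
and the midpoints of inverted arcs. The exception is a line without inverted arcs, where there are
no such points at all and any `G`-invariant subdivision is allowed. -/
def IsStandard (T : GTree G) : Prop :=
  (∃ v, T.IsSuperfluous v) → ∀ v, T.IsSuperfluous v

/-! #### Points of the tree and elliptic subgroups -/

/-- A vertex, or an oriented edge `e` with a number `0 < t < len e` (the point at distance `t` from
the initial vertex of `e`). -/
def PrePoint (T : GTree G) : Type u :=
  T.V ⊕ {p : T.E × ℝ // 0 < p.2 ∧ p.2 < T.len p.1}

/-- The same point, described with the opposite orientation of its edge. -/
def PrePoint.flip {T : GTree G} : T.PrePoint → T.PrePoint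
  | Sum.inl v => Sum.inl v
  | Sum.inr p => Sum.inr ⟨(T.bar p.1.1, T.len p.1.1 - p.1.2),
      by have := p.2.2; simp only; linarith,
      by have := p.2.1; simp only [T.len_bar]; linarith⟩

theorem PrePoint.flip_flip {T : GTree G} (p : T.PrePoint) : p.flip.flip = p := by
  rcases p with v | ⟨⟨e, t⟩, h⟩
  · rfl
  · simp only [PrePoint.flip]
    congr 2
    simp [T.bar_bar, T.len_bar]

instance pointSetoid (T : GTree G) : Setoid T.PrePoint where
  r p q := q = p ∨ q = p.flip
  iseqv :=
    { refl := fun _ => Or.inl rfl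
      symm := by
        rintro p q (rfl | rfl)
        · exact Or.inl rfl
        · exact Or.inr p.flip_flip.symm
      trans := by
        rintro p q r (rfl | rfl) (rfl | rfl)
        · exact Or.inl rfl
        · exact Or.inr rfl
        · exact Or.inr rfl
        · exact Or.inl p.flip_flip }

/-- The points of the metric tree `T`. -/
def Point (T : GTree G) : Type u := Quotient T.pointSetoid

/-- The action of `G` on points, before identification. -/
def PrePoint.act {T : GTree G} (g : G) : T.PrePoint → T.PrePoint
  | Sum.inl v => Sum.inl (g • v)
  | Sum.inr p => Sum.inr ⟨(g • p.1.1, p.1.2), p.2.1, by simpa only [T.len_smul] using p.2.2⟩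

theorem PrePoint.act_flip {T : GTree G} (g : G) (p : T.PrePoint) :
    PrePoint.act g p.flip = (PrePoint.act g p).flip := by
  rcases p with v | ⟨⟨e, t⟩, h⟩
  · rfl
  · simp only [PrePoint.flip, PrePoint.act]
    congr 2
    simp [T.smul_bar, T.len_smul]

theorem PrePoint.act_one {T : GTree G} (p : T.PrePoint) : PrePoint.act (1 : G) p = p := by
  rcases p with v | ⟨⟨e, t⟩, h⟩
  · exact congrArg Sum.inl (one_smul G v)
  · exact congrArg Sum.inr (Subtype.ext (Prod.ext (one_smul G e) rfl))

theorem PrePoint.act_mul {T : GTree G} (g h : G) (p : T.PrePoint) :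
    PrePoint.act (g * h) p = PrePoint.act g (PrePoint.act h p) := by
  rcases p with v | ⟨⟨e, t⟩, ht⟩
  · exact congrArg Sum.inl (mul_smul g h v)
  · exact congrArg Sum.inr (Subtype.ext (Prod.ext (mul_smul g h e) rfl))

instance (T : GTree G) : MulAction G T.Point where
  smul g := Quotient.map (PrePoint.act g) (by
    rintro p q (rfl | rfl)
    · exact Or.inl rfl
    · exact Or.inr (PrePoint.act_flip g p))
  one_smul := by
    rintro ⟨p⟩
    exact congrArg (Quotient.mk T.pointSetoid) p.act_one
  mul_smul := by
    rintro g h ⟨p⟩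
    exact congrArg (Quotient.mk T.pointSetoid) (p.act_mul g h)

/-- A subgroup is elliptic if it fixes a point of `T`. -/
def IsElliptic (T : GTree G) (H : Subgroup G) : Prop :=
  ∃ x : T.Point, ∀ h ∈ H, h • x = x

/-- The set of elliptic subgroups of `T`. -/
def ellipticSubgroups (T : GTree G) : Set (Subgroup G) := {H | T.IsElliptic H}

/-! #### The quotient graph, representative trees and quotient graphs of groups -/

/-- The quotient graph `T / G`. -/
def quot (T : GTree G) : SerreGraph.{u} where
  V := MulAction.orbitRel.Quotient G T.V
  E := MulAction.orbitRel.Quotient G T.E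
  bar := Quotient.map T.bar (by
    rintro _ e ⟨g, rfl⟩
    exact ⟨g, T.smul_bar g e⟩)
  init := Quotient.map T.init (by
    rintro _ e ⟨g, rfl⟩
    exact ⟨g, T.smul_init g e⟩)
  bar_bar := by
    rintro ⟨e⟩
    exact congrArg (Quotient.mk (MulAction.orbitRel G T.E)) (T.bar_bar e)
  bar_ne := by
    rintro ⟨e⟩ h
    obtain ⟨g, hg⟩ : ∃ g : G, g • e = T.bar e := Quotient.exact h
    exact T.no_inversion g e hg

/-- The projection `T → T / G`. -/
def proj (T : GTree G) : SerreGraph.Hom T.toSerreGraph T.quot where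
  onV v := Quotient.mk (MulAction.orbitRel G T.V) v
  onE e := Quotient.mk (MulAction.orbitRel G T.E) e
  onE_bar _ := rfl
  onV_init _ := rfl

theorem quot_isConnected (T : GTree G) : T.quot.IsConnected := by
  obtain ⟨⟨v⟩, h⟩ := T.isTree
  refine ⟨⟨T.proj.onV v⟩, ?_⟩
  rintro ⟨v⟩ ⟨w⟩
  obtain ⟨l, hl, -⟩ := h v w
  exact ⟨_, T.proj.isPath v l w hl.1⟩

/-- `T / G` is compact, that is, a finite graph. -/
def IsCocompact (T : GTree G) : Prop := Finite T.quot.V ∧ Finite T.quot.E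

/-- A maximal (that is, spanning) tree of `T / G` together with a lift `j` of it to `T`. -/
structure TreeLift (T : GTree G) where
  maxTree : SerreGraph.Subgraph T.quot
  isTree : maxTree.toGraph.IsTree
  spanning : ∀ x, x ∈ maxTree.verts
  j : SerreGraph.Hom maxTree.toGraph T.toSerreGraph
  proj_onV : ∀ x, T.proj.onV (j.onV x) = x.1
  proj_onE : ∀ e, T.proj.onE (j.onE e) = e.1

/-- Representative trees: images of lifts of maximal trees of `T / G`. -/
def IsRepresentativeTree (T : GTree G) (T₀ : SerreGraph.Subgraph T.toSerreGraph) : Prop :=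
  ∃ D : T.TreeLift, T₀ = D.j.range

/-- The stabiliser of the lift `j x` of a vertex `x` of `T / G`. -/
def TreeLift.vertexSubgroup {T : GTree G} (D : T.TreeLift) (x : T.quot.V) : Subgroup G :=
  MulAction.stabilizer G (D.j.onV ⟨x, D.spanning x⟩)

/-- The quotient graph of groups of an edge-free `G`-tree determined by a lift of a maximal tree of
`T / G`: the group at `x` is the stabiliser of `j x`, and all edge groups are trivial. -/
def TreeLift.quotientGraphOfGroups {T : GTree G} (D : T.TreeLift) (_ : T.IsEdgeFree) :
    MetricGraphOfGroups.{u} where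
  graph := T.quot
  connected := T.quot_isConnected
  len := Quotient.lift T.len (by
    rintro _ e ⟨g, rfl⟩
    exact T.len_smul g e)
  len_pos := by
    rintro ⟨e⟩
    exact T.len_pos e
  len_bar := by
    rintro ⟨e⟩
    exact T.len_bar e
  vertexGroup x := D.vertexSubgroup x
  edgeGroup _ := PUnit
  ρ _ := 1
  ρ_injective _ _ _ _ := rfl

end GTree

/-! ### Free products and free factor systems -/

section

variable {G : Type u} [Group G]

/-- `G = H₁ * ... * H_k * F_r` as an internal free product, `F_r` being free of rank `r`. -/
def IsFreeProductDecomposition {k : ℕ} (H : Fin k → Subgroup G) (r : ℕ) : Prop :=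
  ∃ x : Fin r → G, Function.Bijective
    (Monoid.Coprod.lift (Monoid.CoprodI.lift fun i => (H i).subtype) (FreeGroup.lift x))

/-- The nontrivial vertex stabilisers in `T₀` are exactly `H₁, ..., H_k` (one for each vertex of
`T₀` with nontrivial stabiliser). -/
def StabilisersAreExactly (T : GTree G) (T₀ : SerreGraph.Subgraph T.toSerreGraph) {k : ℕ}
    (H : Fin k → Subgroup G) : Prop :=
  ∃ σ : Fin k ≃ {v : T.V // v ∈ T₀.verts ∧ MulAction.stabilizer G v ≠ ⊥},
    ∀ i, H i = MulAction.stabilizer G (σ i).1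

/-- The nontrivial vertex groups of the quotient graph of groups determined by `D` are exactly the
subgroups `H₁, ..., H_k` of `G` (one for each vertex with nontrivial vertex group). -/
def VertexGroupsAreExactly {T : GTree G} (hT : T.IsEdgeFree) (D : T.TreeLift) {k : ℕ}
    (H : Fin k → Subgroup G) : Prop :=
  ∃ σ : Fin k ≃ {x : (D.quotientGraphOfGroups hT).graph.V //
      Nontrivial ((D.quotientGraphOfGroups hT).vertexGroup x)},
    ∀ i, H i = D.vertexSubgroup (σ i).1

/-- Free factor systems: sets of elliptic subgroups of minimal, cocompact, edge-free `G`-trees. -/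
def IsFreeFactorSystem (𝒢 : Set (Subgroup G)) : Prop :=
  ∃ T : GTree G, T.IsStandard ∧ T.IsMinimal ∧ T.IsCocompact ∧ T.IsEdgeFree ∧
    𝒢 = T.ellipticSubgroups

/-- The conjugacy class of a subgroup. -/
def subgroupConjClass (H : Subgroup G) : Set (Subgroup G) :=
  {K | ∃ g : G, K = H.map (MulAut.conj g).toMonoidHom}

/-- Traditional free factor systems: the sets `{[G₁], ..., [G_k]}` of conjugacy classes for
decompositions `G = G₁ * ... * G_k * F_r` with nontrivial `G_i`. The empty set is the case
`k = 0`, `G = F_r`. -/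
def IsTraditionalFreeFactorSystem (𝒞 : Set (Set (Subgroup G))) : Prop :=
  ∃ (k r : ℕ) (H : Fin k → Subgroup G), (∀ i, H i ≠ ⊥) ∧ IsFreeProductDecomposition H r ∧
    𝒞 = Set.range fun i => subgroupConjClass (H i)

/-- `𝒞` can be obtained from the free factor system `𝒢` in this way: choose a tree `T` with
`𝒢 = 𝒢_T` and a representative tree in `T`, and take the conjugacy classes of its nontrivial
vertex groups. -/
def YieldsTraditional (𝒢 : Set (Subgroup G)) (𝒞 : Set (Set (Subgroup G))) : Prop :=
  ∃ T : GTree G, T.IsStandard ∧ T.IsMinimal ∧ T.IsCocompact ∧ T.IsEdgeFree ∧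
    𝒢 = T.ellipticSubgroups ∧
    ∃ T₀, T.IsRepresentativeTree T₀ ∧
      𝒞 = {C | ∃ v ∈ T₀.verts, MulAction.stabilizer G v ≠ ⊥ ∧
        C = subgroupConjClass (MulAction.stabilizer G v)}

/-- `𝒢` can be obtained from the traditional free factor system `𝒞` in this way: choose a
decomposition `G = G₁ * ... * G_k * F_r` with `𝒞 = {[G₁], ..., [G_k]}` and a tree `T` with a
representative tree whose nontrivial vertex stabilisers are exactly `G₁, ..., G_k`, and take the
elliptic subgroups of `T`. -/
def YieldsFreeFactorSystem (𝒞 : Set (Set (Subgroup G))) (𝒢 : Set (Subgroup G)) : Prop :=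
  ∃ (k r : ℕ) (H : Fin k → Subgroup G), (∀ i, H i ≠ ⊥) ∧ IsFreeProductDecomposition H r ∧
    𝒞 = (Set.range fun i => subgroupConjClass (H i)) ∧
    ∃ T : GTree G, T.IsStandard ∧ T.IsMinimal ∧ T.IsCocompact ∧ T.IsEdgeFree ∧
      (∃ T₀, T.IsRepresentativeTree T₀ ∧ StabilisersAreExactly T T₀ H) ∧
      𝒢 = T.ellipticSubgroups

end

/-! ### Paths, reduction and potentials in Serre graphs -/

namespace SerreGraph

variable {X Y : SerreGraph.{u}}

/-! This is Bass-Serre theory for trivial edge groups, built on group-valued cocycles on trees. A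
labelling of oriented edges with `c (bar e) = (c e)⁻¹` keeps its product along a path when
backtracking is cancelled, so on a tree it is the coboundary of a potential
(`IsTree.exists_potential`).

From trees to free products (`TreeLift.isInternalFreeProduct`): since `T` is connected, `G` is
generated by the stabilisers along a representative tree and one element `t e` for each remaining
edge of the quotient. Given homomorphisms on these stabilisers and values for the `t e`, trivial
edge stabilisers allow the data to be encoded as a cocycle on `T`. Its potential yields a function
on `G` which is multiplicative up to normalisation; this is the common extension.

From free products to trees (`exists_tree_of_isInternalFreeProduct`): the vertices are the cosets of
the factors, the quotient is a star with loops, and connectedness says that the factors and the free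
generators generate. Uniqueness of reduced paths comes from a potential with values in the free
group on the edges (`exists_starPotential`); that potential is obtained by applying the universal
property to a semidirect product.

For the corollary, a nontrivial element fixes at most one vertex of an edge-free tree
(`IsEdgeFree.eq_of_fixed`), so nontrivial vertex stabilisers are the maximal nontrivial elliptic
subgroups. Hence the elliptic subgroups and the conjugacy classes determine each other through
`maximalClasses` and `subordinateSubgroups`, which mention no tree. This gives both the bijection
and independence of choices. -/

theorem term_bar (Y : SerreGraph.{u}) (e : Y.E) : Y.term (Y.bar e) = Y.init e := by
  rw [term, Y.bar_bar]

theorem Hom.onV_term (f : Hom X Y) (e : X.E) : f.onV (X.term e) = Y.term (f.onE e) := by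
  rw [term, f.onV_init, f.onE_bar, term]

theorem IsPath.append : ∀ {l l' : List Y.E} {u v w : Y.V},
    Y.IsPath u l v → Y.IsPath v l' w → Y.IsPath u (l ++ l') w
  | [], _, _, _, _, h, h' => by
      cases (show _ = _ from h)
      exact h'
  | _ :: _, _, _, _, _, h, h' => ⟨h.1, IsPath.append h.2 h'⟩

theorem isPath_singleton (e : Y.E) : Y.IsPath (Y.init e) [e] (Y.term e) := ⟨rfl, rfl⟩

theorem IsPath.reverse : ∀ {l : List Y.E} {v w : Y.V},
    Y.IsPath v l w → Y.IsPath w (l.map Y.bar).reverse v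
  | [], _, _, h => Eq.symm h
  | e :: l, v, w, h => by
      rw [List.map_cons, List.reverse_cons]
      refine IsPath.append (IsPath.reverse h.2) ⟨rfl, ?_⟩
      rw [term_bar]
      exact h.1

theorem isConnected_of_forall_isPath (v₀ : Y.V) (h : ∀ v, ∃ l, Y.IsPath v₀ l v) :
    Y.IsConnected := by
  refine ⟨⟨v₀⟩, fun v w => ?_⟩
  obtain ⟨l, hl⟩ := h v
  obtain ⟨l', hl'⟩ := h w
  exact ⟨_, hl.reverse.append hl'⟩

theorem IsPath.induction {P : Y.V → Prop} (step : ∀ e, P (Y.init e) → P (Y.term e)) :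
    ∀ {l : List Y.E} {v w : Y.V}, Y.IsPath v l w → P v → P w
  | [], _, _, h, hv => by
      cases (show _ = _ from h)
      exact hv
  | e :: _, _, _, h, hv => IsPath.induction step h.2 (step e (h.1 ▸ hv))

theorem IsConnected.induction (hY : Y.IsConnected) {P : Y.V → Prop} {v₀ : Y.V} (h₀ : P v₀)
    (step : ∀ e, P (Y.init e) → P (Y.term e)) (v : Y.V) : P v := by
  obtain ⟨l, hl⟩ := hY.2 v₀ v
  exact hl.induction step h₀

/-- Every path can be reduced without changing its value under a given cocycle. -/
theorem IsPath.exists_isReduced {K : Type*} [Group K] {c : Y.E → K}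
    (hc : ∀ e, c (Y.bar e) = (c e)⁻¹) : ∀ {l : List Y.E} {v w : Y.V}, Y.IsPath v l w →
      ∃ l', Y.IsPath v l' w ∧ Y.IsReduced l' ∧ (l'.map c).prod = (l.map c).prod
  | [], _, _, h => ⟨[], h, List.isChain_nil, rfl⟩
  | e :: l, v, w, h => by
      obtain ⟨l', hl', hr, hp⟩ := IsPath.exists_isReduced hc h.2
      rw [List.map_cons, List.prod_cons, ← hp]
      cases l' with
      | nil => exact ⟨[e], ⟨h.1, hl'⟩, List.isChain_singleton _, by simp⟩
      | cons f l' =>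
        by_cases hf : f = Y.bar e
        · subst hf
          refine ⟨l', ?_, hr.tail, by simp [hc]⟩
          have := hl'.2
          rwa [term_bar, h.1] at this
        · exact ⟨e :: f :: l', ⟨h.1, hl'⟩, List.isChain_cons_cons.2 ⟨hf, hr⟩, by simp⟩

theorem IsConnected.exists_isReduced (hY : Y.IsConnected) (v w : Y.V) :
    ∃ l, Y.IsPath v l w ∧ Y.IsReduced l := by
  obtain ⟨l, hl⟩ := hY.2 v w
  obtain ⟨l', h, hr, -⟩ := hl.exists_isReduced (c := fun _ => (1 : Multiplicative ℤ)) (by simp)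
  exact ⟨l', h, hr⟩

theorem IsTree.isConnected (hY : Y.IsTree) : Y.IsConnected :=
  ⟨hY.1, fun v w => (hY.2 v w).exists.imp fun _ h => h.1⟩

theorem IsTree.path_eq (hY : Y.IsTree) {v w : Y.V} {l l' : List Y.E} (h : Y.IsPath v l w)
    (hr : Y.IsReduced l) (h' : Y.IsPath v l' w) (hr' : Y.IsReduced l') : l = l' :=
  (hY.2 v w).unique ⟨h, hr⟩ ⟨h', hr'⟩

theorem IsTree.edge_eq (hY : Y.IsTree) {e f : Y.E} (hi : Y.init e = Y.init f)
    (ht : Y.term e = Y.term f) : e = f := by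
  have := hY.path_eq (l' := [f]) (isPath_singleton e) (List.isChain_singleton _)
    (by rw [hi, ht]; exact isPath_singleton f) (List.isChain_singleton _)
  simpa using this

/-- On a tree, every cocycle with values in a group is the coboundary of a potential. -/
theorem IsTree.exists_potential (hY : Y.IsTree) {K : Type*} [Group K] {c : Y.E → K}
    (hc : ∀ e, c (Y.bar e) = (c e)⁻¹) :
    ∃ F : Y.V → K, ∀ e, F (Y.term e) = F (Y.init e) * c e := by
  obtain ⟨v₀⟩ := hY.1
  choose p hp using fun v => (hY.2 v₀ v).exists
  refine ⟨fun v => ((p v).map c).prod, fun e => ?_⟩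
  -- The chosen path followed by `e` may backtrack. Its reduction has the same product and, by
  -- uniqueness, is the chosen path to the end of `e`.
  obtain ⟨l', h, hr, hl⟩ := ((hp (Y.init e)).1.append (isPath_singleton e)).exists_isReduced hc
  simp only
  rw [hY.path_eq (hp _).1 (hp _).2 h hr, hl]
  simp

theorem Hom.isReduced {f : Hom X Y} (hf : Function.Injective f.onE) {l : List X.E}
    (hl : X.IsReduced l) : Y.IsReduced (l.map f.onE) := by
  refine List.isChain_map_of_isChain _ (fun a b hab h => hab ?_) hl
  rw [← f.onE_bar] at h
  exact hf h

/-- Reduced paths map to reduced paths and are lists of edges, so injectivity on edges pulls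
uniqueness back. -/
theorem IsTree.of_hom (hY : Y.IsTree) (hX : X.IsConnected) (f : Hom X Y)
    (hf : Function.Injective f.onE) : X.IsTree := by
  refine ⟨hX.1, fun v w => ?_⟩
  obtain ⟨l, hl, hr⟩ := hX.exists_isReduced v w
  refine ⟨l, ⟨hl, hr⟩, fun l' h' => ?_⟩
  exact hf.list_map (hY.path_eq (f.isPath _ _ _ h'.1) (Hom.isReduced hf h'.2)
    (f.isPath _ _ _ hl) (Hom.isReduced hf hr))

/-- The inclusion of a subgraph. -/
def Subgraph.incl (S : Subgraph Y) : Hom S.toGraph Y where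
  onV := Subtype.val
  onE := Subtype.val
  onE_bar _ := rfl
  onV_init _ := rfl

theorem Subgraph.term_mem (S : Subgraph Y) {e : Y.E} (he : e ∈ S.edges) : Y.term e ∈ S.verts :=
  S.init_mem _ (S.bar_mem _ he)

/-- A connected subgraph of a tree contains every reduced path between its vertices. -/
theorem IsTree.mem_edges_of_isPath (hY : Y.IsTree) {S : Subgraph Y} (hS : S.toGraph.IsConnected)
    {v w : Y.V} (hv : v ∈ S.verts) (hw : w ∈ S.verts) {l : List Y.E} (hl : Y.IsPath v l w)
    (hr : Y.IsReduced l) {e : Y.E} (he : e ∈ l) : e ∈ S.edges := by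
  obtain ⟨l', h', hr'⟩ := hS.exists_isReduced ⟨v, hv⟩ ⟨w, hw⟩
  rw [hY.path_eq hl hr (S.incl.isPath _ _ _ h') (Hom.isReduced Subtype.val_injective hr')] at he
  obtain ⟨f, -, rfl⟩ := List.mem_map.1 he
  exact f.2

/-- The full subgraph on a set of vertices. -/
def fullSubgraph (Y : SerreGraph.{u}) (S : Set Y.V) : Subgraph Y where
  verts := S
  edges := {e | Y.init e ∈ S ∧ Y.term e ∈ S}
  bar_mem := fun e h => ⟨h.2, by rw [term_bar]; exact h.1⟩
  init_mem := fun _ h => h.1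

end SerreGraph

/-! ### Fixed points in edge-free trees -/

namespace GTree

variable {G : Type u} [Group G]

/-- The action of an element of `G` on a `G`-tree. -/
def smulHom (T : GTree G) (g : G) : SerreGraph.Hom T.toSerreGraph T.toSerreGraph where
  onV v := g • v
  onE e := g • e
  onE_bar e := T.smul_bar g e
  onV_init e := T.smul_init g e

theorem smul_term (T : GTree G) (g : G) (e : T.E) : g • T.term e = T.term (g • e) :=
  (T.smulHom g).onV_term e

theorem IsEdgeFree.eq_of_smul_eq {T : GTree G} (hT : T.IsEdgeFree) {e : T.E} {g h : G}
    (hg : g • e = h • e) : g = h := by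
  have := hT e (h⁻¹ * g) (Or.inl (by rw [mul_smul, hg, inv_smul_smul]))
  rw [inv_mul_eq_one] at this
  exact this.symm

/-- In an edge-free tree, a nontrivial element fixes at most one vertex. -/
theorem IsEdgeFree.eq_of_fixed {T : GTree G} (hT : T.IsEdgeFree) {g : G} (hg : g ≠ 1) {v w : T.V}
    (hv : g • v = v) (hw : g • w = w) : v = w := by
  obtain ⟨l, hl, hr⟩ := (T.isTree.2 v w).exists
  -- `g` maps the reduced path from `v` to `w` to itself and would therefore fix its first edge.
  have h := T.isTree.path_eq hl hr (l' := l.map (g • ·))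
    (by simpa only [smulHom, hv, hw] using (T.smulHom g).isPath _ _ _ hl)
    (SerreGraph.Hom.isReduced (f := T.smulHom g) (MulAction.injective g) hr)
  cases l with
  | nil => exact hl
  | cons e l =>
    rw [List.map_cons, List.cons_eq_cons] at h
    exact absurd (hT e g (Or.inl h.1.symm)) hg

end GTree

/-! ### Internal free products by their universal property -/

/-- `G` is the internal free product of the subgroups `B i` and the free group on the `x j`,
expressed by the universal property. -/
structure IsInternalFreeProduct {G : Type u} [Group G] {ι κ : Type*} (B : ι → Subgroup G)
    (x : κ → G) : Prop where
  extend : ∀ (K : Type u) [Group K] (β : ∀ i, B i →* K) (y : κ → K),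
    ∃ φ : G →* K, (∀ i (b : B i), φ b = β i b) ∧ ∀ j, φ (x j) = y j
  generate : ∀ M : Subgroup G, (∀ i, B i ≤ M) → (∀ j, x j ∈ M) → M = ⊤

section

variable {G : Type u} [Group G]

/-- Extending the canonical inclusions to `G` gives a left inverse of the map `Λ` from the external
free product, and generation makes `Λ` surjective. Targets in `Type u` suffice because that free
product itself lives there. -/
theorem isFreeProductDecomposition_iff {k : ℕ} (H : Fin k → Subgroup G) (r : ℕ) :
    IsFreeProductDecomposition H r ↔ ∃ x : Fin r → G, IsInternalFreeProduct H x := by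
  refine exists_congr fun x => ?_
  set Λ := Monoid.Coprod.lift (Monoid.CoprodI.lift fun i => (H i).subtype) (FreeGroup.lift x)
    with hΛ
  have hH : ∀ i (b : H i), Λ (Monoid.Coprod.inl (Monoid.CoprodI.of b)) = (b : G) := fun i b => by
    simp [hΛ]
  have hx : ∀ j, Λ (Monoid.Coprod.inr (FreeGroup.of j)) = x j := fun j => by simp [hΛ]
  constructor
  · intro h
    refine ⟨fun K _ β y => ?_, fun M hM hxM => ?_⟩
    · let e := MulEquiv.ofBijective Λ h
      refine ⟨(Monoid.Coprod.lift (Monoid.CoprodI.lift β) (FreeGroup.lift y)).comp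
        e.symm.toMonoidHom, fun i b => ?_, fun j => ?_⟩
      · have : e.symm (b : G) =
            Monoid.Coprod.inl (Monoid.CoprodI.of (M := fun i => H i) b) := by
          rw [MulEquiv.symm_apply_eq]; exact (hH i b).symm
        simp [this]
      · have : e.symm (x j) = Monoid.Coprod.inr (FreeGroup.of j) := by
          rw [MulEquiv.symm_apply_eq]; exact (hx j).symm
        simp [this]
    · rw [eq_top_iff]
      intro g _
      obtain ⟨p, rfl⟩ := h.2 g
      let ψ := Monoid.Coprod.lift (Monoid.CoprodI.lift fun i => Subgroup.inclusion (hM i))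
        (FreeGroup.lift fun j => (⟨x j, hxM j⟩ : M))
      have : M.subtype.comp ψ = Λ := by
        apply Monoid.Coprod.hom_ext
        · ext i b
          simp [ψ, hΛ]
        · ext j
          simp [ψ, hΛ]
      rw [← this]
      exact (ψ p).2
  · intro h
    constructor
    · obtain ⟨φ, h₁, h₂⟩ := h.extend _
        (fun i => Monoid.Coprod.inl.comp (Monoid.CoprodI.of (M := fun i => H i) (i := i)))
        (fun j => Monoid.Coprod.inr (FreeGroup.of j))
      have : φ.comp Λ = MonoidHom.id _ := by
        apply Monoid.Coprod.hom_ext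
        · ext i b
          simp [hΛ, h₁]
        · ext j
          simp [hΛ, h₂]
      exact Function.LeftInverse.injective (g := φ) (DFunLike.congr_fun this)
    · rw [← MonoidHom.range_eq_top]
      exact h.generate _ (fun i b hb => ⟨_, hH i ⟨b, hb⟩⟩) (fun j => ⟨_, hx j⟩)

namespace IsInternalFreeProduct

variable {ι ι' κ κ' : Type*} {B : ι → Subgroup G} {x : κ → G}

theorem reindex (h : IsInternalFreeProduct B x) (e : κ' ≃ κ) :
    IsInternalFreeProduct B (x ∘ e) := by
  refine ⟨fun K _ β y => ?_, fun M hM hx => h.generate M hM fun j => ?_⟩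
  · obtain ⟨φ, h₁, h₂⟩ := h.extend K β (y ∘ e.symm)
    exact ⟨φ, h₁, fun j => by simp [h₂]⟩
  · simpa using hx (e.symm j)

/-- Trivial factors can be added. -/
theorem of_comp {σ : ι' → ι} (h : IsInternalFreeProduct (B ∘ σ) x)
    (hB : ∀ i, i ∉ Set.range σ → B i = ⊥) : IsInternalFreeProduct B x := by
  refine ⟨fun K _ β y => ?_, fun M hM hx => h.generate M (fun i => hM (σ i)) hx⟩
  obtain ⟨φ, h₁, h₂⟩ := h.extend K (fun i => β (σ i)) y
  refine ⟨φ, fun i b => ?_, h₂⟩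
  by_cases hi : i ∈ Set.range σ
  · obtain ⟨i, rfl⟩ := hi
    exact h₁ i b
  · have hb : b = 1 := Subtype.ext ((Subgroup.mem_bot (G := G)).1 (hB i hi ▸ b.2))
    simp [hb]

/-- Trivial factors can be omitted. -/
theorem comp {σ : ι' → ι} (h : IsInternalFreeProduct B x) (hσ : Function.Injective σ)
    (hB : ∀ i, i ∉ Set.range σ → B i = ⊥) : IsInternalFreeProduct (B ∘ σ) x := by
  refine ⟨fun K _ β y => ?_, fun M hM hx => h.generate M (fun i => ?_) hx⟩
  · have : ∀ i, ∃ β' : B i →* K, ∀ i' (hi : i = σ i') (b : B i),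
        β' b = β i' ⟨b, hi ▸ b.2⟩ := by
      intro i
      by_cases hi : i ∈ Set.range σ
      · obtain ⟨i', rfl⟩ := hi
        refine ⟨β i', fun j hj b => ?_⟩
        cases hσ hj
        rfl
      · exact ⟨1, fun i' h => absurd ⟨i', h.symm⟩ hi⟩
    choose β' hβ' using this
    obtain ⟨φ, h₁, h₂⟩ := h.extend K β' y
    exact ⟨φ, fun i b => by rw [h₁ (σ i) b, hβ' _ i rfl], h₂⟩
  · by_cases hi : i ∈ Set.range σ
    · obtain ⟨i', rfl⟩ := hi
      exact hM i'
    · rw [hB i hi]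
      exact bot_le

end IsInternalFreeProduct

end

/-! ### Orientations and cocycles from edge labels -/

namespace SerreGraph

theorem exists_orientation (Y : SerreGraph.{u}) : ∃ P : Set Y.E, ∀ e, Y.bar e ∈ P ↔ e ∉ P := by
  refine ⟨{e | WellOrderingRel e (Y.bar e)}, fun e => ?_⟩
  simp only [Set.mem_ofPred_eq, Y.bar_bar]
  constructor
  · exact fun h h' => asymm_of WellOrderingRel h h'
  · intro h
    rcases trichotomous_of WellOrderingRel e (Y.bar e) with h' | h' | h'
    · exact absurd h' h
    · exact absurd h'.symm (Y.bar_ne e)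
    · exact h'

/-- Labels on the positive edges outside a subgraph extend to a cocycle trivial on the subgraph. -/
theorem Subgraph.exists_cocycle {Y : SerreGraph.{u}} (S : Subgraph Y) {P : Set Y.E}
    (hP : ∀ e, Y.bar e ∈ P ↔ e ∉ P) {K : Type*} [Group K]
    (y : {e : Y.E // e ∉ S.edges ∧ e ∈ P} → K) :
    ∃ τ : Y.E → K, (∀ e, τ (Y.bar e) = (τ e)⁻¹) ∧ (∀ e ∈ S.edges, τ e = 1) ∧
      ∀ e, τ e.1 = y e := by
  classical
  have hbar : ∀ e, Y.bar e ∈ S.edges ↔ e ∈ S.edges := fun e =>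
    ⟨fun h => by simpa only [Y.bar_bar] using S.bar_mem _ h, S.bar_mem e⟩
  let τ : Y.E → K := fun e => if he : e ∈ S.edges then 1 else
    if hp : e ∈ P then y ⟨e, he, hp⟩ else (y ⟨Y.bar e, mt (hbar e).1 he, (hP e).2 hp⟩)⁻¹
  refine ⟨τ, fun e => ?_, fun e he => dif_pos he, fun e => ?_⟩
  · by_cases he : e ∈ S.edges
    · simp [τ, he, S.bar_mem e he]
    · have he' := mt (hbar e).1 he
      by_cases hp : e ∈ P
      · have hp' : Y.bar e ∉ P := fun h => (hP e).1 h hp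
        simp only [τ, dif_neg he, dif_neg he', dif_pos hp, dif_neg hp', Y.bar_bar]
      · simp only [τ, dif_neg he, dif_neg he', dif_neg hp, dif_pos ((hP e).2 hp), inv_inv]
  · simp only [τ, dif_neg e.2.1, dif_pos e.2.2]

end SerreGraph

/-! ### The structure theorem for edge-free trees -/

namespace GTree

variable {G : Type u} [Group G] {T : GTree G}

/-- The lift of a vertex of `T / G`. -/
def TreeLift.base (D : T.TreeLift) (x : T.quot.V) : T.V := D.j.onV ⟨x, D.spanning x⟩

theorem TreeLift.proj_base (D : T.TreeLift) (x : T.quot.V) : T.proj.onV (D.base x) = x :=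
  D.proj_onV ⟨x, D.spanning x⟩

theorem exists_smul_of_proj_eq {v w : T.V} (h : T.proj.onV v = T.proj.onV w) :
    ∃ g : G, g • w = v := Quotient.exact h

theorem exists_smul_of_proj_edge_eq {e f : T.E} (h : T.proj.onE e = T.proj.onE f) :
    ∃ g : G, g • f = e := Quotient.exact h

theorem proj_smul (g : G) (v : T.V) : T.proj.onV (g • v) = T.proj.onV v :=
  Quotient.sound ⟨g, rfl⟩

theorem proj_smul_edge (g : G) (e : T.E) : T.proj.onE (g • e) = T.proj.onE e :=
  Quotient.sound ⟨g, rfl⟩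

theorem proj_edge_surjective : Function.Surjective T.proj.onE := Quotient.exists_rep

theorem proj_surjective : Function.Surjective T.proj.onV := Quotient.exists_rep

theorem exists_edge_at {e : T.quot.E} {v : T.V} (h : T.proj.onV v = T.quot.init e) :
    ∃ f : T.E, T.proj.onE f = e ∧ T.init f = v := by
  obtain ⟨f, rfl⟩ := proj_edge_surjective e
  rw [← T.proj.onV_init] at h
  obtain ⟨g, hg⟩ := exists_smul_of_proj_eq h
  exact ⟨g • f, proj_smul_edge g f, by rw [← T.smul_init, hg]⟩

/-- Lifts `L e` of the edges of `T / G` starting in the chosen lift of the maximal tree, with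
elements `t e` carrying that lift to the terminal vertices. -/
theorem TreeLift.exists_edgeLift (D : T.TreeLift) {P : Set T.quot.E}
    (hP : ∀ e, T.quot.bar e ∈ P ↔ e ∉ P) :
    ∃ (L : T.quot.E → T.E) (t : T.quot.E → G), (∀ e, T.proj.onE (L e) = e) ∧
      (∀ e, T.init (L e) = D.base (T.quot.init e)) ∧
      (∀ e, L (T.quot.bar e) = (t e)⁻¹ • T.bar (L e)) ∧
      (∀ e, t (T.quot.bar e) = (t e)⁻¹) ∧ ∀ e ∈ D.maxTree.edges, t e = 1 := by
  classical
  choose L₀ hL₀ hi₀ using fun e => exists_edge_at (D.proj_base (T.quot.init e))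
  have : ∀ e, ∃ g : G, g • D.base (T.quot.term e) = T.term (L₀ e) := fun e =>
    exists_smul_of_proj_eq (by rw [T.proj.onV_term, hL₀, D.proj_base])
  choose t₀ ht₀ using this
  obtain ⟨t, ht, ht₁, ht₂⟩ := D.maxTree.exists_cocycle hP fun e => t₀ e.1
  have hbar : ∀ e, T.quot.bar e ∈ D.maxTree.edges ↔ e ∈ D.maxTree.edges := fun e =>
    ⟨fun h => by simpa only [T.quot.bar_bar] using D.maxTree.bar_mem _ h, D.maxTree.bar_mem e⟩
  -- Lifts come from `j` on the maximal tree and are free on other positive edges; on negative ones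
  -- they are forced by the relation between `L (bar e)` and `L e`.
  let L : T.quot.E → T.E := fun e => if he : e ∈ D.maxTree.edges then D.j.onE ⟨e, he⟩ else
    if e ∈ P then L₀ e else (t (T.quot.bar e))⁻¹ • T.bar (L₀ (T.quot.bar e))
  refine ⟨L, t, fun e => ?_, fun e => ?_, fun e => ?_, ht, ht₁⟩
  · by_cases he : e ∈ D.maxTree.edges
    · simp only [L, dif_pos he]
      exact D.proj_onE ⟨e, he⟩
    · by_cases hp : e ∈ P
      · simp only [L, dif_neg he, if_pos hp, hL₀]
      · simp only [L, dif_neg he, if_neg hp, proj_smul_edge, T.proj.onE_bar, hL₀, T.quot.bar_bar]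
  · by_cases he : e ∈ D.maxTree.edges
    · simp only [L, dif_pos he]
      exact (D.j.onV_init ⟨e, he⟩).symm
    · by_cases hp : e ∈ P
      · simp only [L, dif_neg he, if_pos hp, hi₀]
      · have h := ht₂ ⟨T.quot.bar e, mt (hbar e).1 he, (hP e).2 hp⟩
        simp only [L, dif_neg he, if_neg hp]
        rw [← T.smul_init, inv_smul_eq_iff, h, ← T.quot.term_bar, ht₀]
        rfl
  · by_cases he : e ∈ D.maxTree.edges
    · simp only [L, dif_pos he, dif_pos (D.maxTree.bar_mem e he), ht₁ e he, inv_one, one_smul]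
      exact D.j.onE_bar ⟨e, he⟩
    · have he' := mt (hbar e).1 he
      by_cases hp : e ∈ P
      · have hp' : T.quot.bar e ∉ P := fun h => (hP e).1 h hp
        simp only [L, dif_neg he, dif_neg he', if_pos hp, if_neg hp', T.quot.bar_bar]
      · simp only [L, dif_neg he, dif_neg he', if_neg hp, if_pos ((hP e).2 hp), ← T.smul_bar,
          T.bar_bar, ht e, inv_inv, inv_smul_smul]

/-- The structure theorem for edge-free trees: the group is the free product of the stabilisers of
the vertices of a representative tree and a free group, with one generator for each geometric edge
outside the maximal tree. -/
theorem TreeLift.isInternalFreeProduct (D : T.TreeLift) (hT : T.IsEdgeFree) {P : Set T.quot.E}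
    (hP : ∀ e, T.quot.bar e ∈ P ↔ e ∉ P) :
    ∃ x : {e : T.quot.E // e ∉ D.maxTree.edges ∧ e ∈ P} → G,
      IsInternalFreeProduct D.vertexSubgroup x := by
  obtain ⟨L, t, hL, hLi, hLb, htb, ht₁⟩ := D.exists_edgeLift hP
  have hmem : ∀ {x : T.quot.V} {g : G}, g ∈ D.vertexSubgroup x ↔ g • D.base x = D.base x :=
    Iff.rfl
  have hLt : ∀ e, T.term (L e) = t e • D.base (T.quot.term e) := fun e => by
    have : T.bar (L e) = t e • L (T.quot.bar e) := by rw [hLb, smul_inv_smul]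
    rw [SerreGraph.term, this, ← T.smul_init, hLi, SerreGraph.term]
  have hmaxTree := D.isTree.isConnected
  have hconn := T.isTree.isConnected
  obtain ⟨⟨x₀, hx₀⟩⟩ := hmaxTree.1
  -- every element is a product of generators
  have hgen : ∀ M : Subgroup G, (∀ x, D.vertexSubgroup x ≤ M) → (∀ e, t e ∈ M) → M = ⊤ := by
    intro M hM ht
    -- Connectedness propagates along edges of `T` that `M` already moves the representatives onto
    -- every vertex; the rest of `G` then differs from `M` by a stabiliser.
    have key : ∀ v : T.V, ∃ m ∈ M, m • D.base (T.proj.onV v) = v := by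
      refine hconn.induction (v₀ := D.base x₀) ⟨1, M.one_mem, ?_⟩ ?_
      · rw [D.proj_base, one_smul]
      · rintro e ⟨m, hm, hv⟩
        obtain ⟨g, hg⟩ := exists_smul_of_proj_edge_eq (hL (T.proj.onE e))
        have hge : e = g⁻¹ • L (T.proj.onE e) := by rw [← hg, inv_smul_smul]
        have hi : T.init e = g⁻¹ • D.base (T.proj.onV (T.init e)) := by
          conv_lhs => rw [hge]
          rw [← T.smul_init, hLi, ← T.proj.onV_init]
        have hgm : g⁻¹ ∈ M := by
          have : m⁻¹ * g⁻¹ ∈ M := hM (T.proj.onV (T.init e)) (hmem.2 (by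
            rw [mul_smul, ← hi, inv_smul_eq_iff, hv]))
          simpa using M.mul_mem hm this
        refine ⟨g⁻¹ * t (T.proj.onE e), M.mul_mem hgm (ht _), ?_⟩
        conv_rhs => rw [hge]
        rw [← T.smul_term, hLt, mul_smul, T.proj.onV_term]
    rw [eq_top_iff]
    intro g _
    obtain ⟨m, hm, h⟩ := key (g • D.base x₀)
    rw [proj_smul, D.proj_base] at h
    have : m⁻¹ * g ∈ M := hM x₀ (hmem.2 (by rw [mul_smul, ← h, inv_smul_smul]))
    simpa using M.mul_mem hm this
  have hgen' : ∀ M : Subgroup G, (∀ x, D.vertexSubgroup x ≤ M) →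
      (∀ e : {e : T.quot.E // e ∉ D.maxTree.edges ∧ e ∈ P}, t e ∈ M) → M = ⊤ := by
    refine fun M hM ht => hgen M hM fun e => ?_
    by_cases he : e ∈ D.maxTree.edges
    · rw [ht₁ e he]; exact M.one_mem
    · by_cases hp : e ∈ P
      · exact ht ⟨e, he, hp⟩
      · have := ht ⟨T.quot.bar e, fun h => he (by
          simpa only [T.quot.bar_bar] using D.maxTree.bar_mem _ h), (hP e).2 hp⟩
        rw [htb] at this
        exact M.inv_mem_iff.1 this
  refine ⟨fun e => t e.1, fun K _ β y => ?_, hgen'⟩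
  obtain ⟨τ, hτb, hτ₁, hτy⟩ := D.maxTree.exists_cocycle hP y
  classical
  -- The default value 1 is harmless: `ι x` is only evaluated on the vertex group at `x`.
  let ι : T.quot.V → G → K := fun x g =>
    if h : g ∈ D.vertexSubgroup x then β x ⟨g, h⟩ else 1
  have hι : ∀ x (g : D.vertexSubgroup x), ι x g = β x g := fun x g => dif_pos g.2
  have hιmul : ∀ {x g h}, g ∈ D.vertexSubgroup x → h ∈ D.vertexSubgroup x →
      ι x (g * h) = ι x g * ι x h := fun {x g h} hg hh => by
    rw [hι x ⟨g, hg⟩, hι x ⟨h, hh⟩, ← map_mul, ← hι]; rfl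
  have hιinv : ∀ {x g}, g ∈ D.vertexSubgroup x → ι x g⁻¹ = (ι x g)⁻¹ := fun {x g} hg => by
    rw [hι x ⟨g, hg⟩, ← map_inv, ← hι]; rfl
  have hs : ∀ v : T.V, ∃ g : G, g • D.base (T.proj.onV v) = v := fun v =>
    exists_smul_of_proj_eq (D.proj_base _).symm
  choose s hs using hs
  have hρ : ∀ e : T.E, ∃ g : G, g • L (T.proj.onE e) = e := fun e =>
    exists_smul_of_proj_edge_eq (hL _).symm
  choose ρ hρ using hρ
  have hρi : ∀ e, ρ e • D.base (T.proj.onV (T.init e)) = T.init e := fun e => by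
    conv_rhs => rw [← hρ e]
    rw [← T.smul_init, hLi, T.proj.onV_init]
  have hρt : ∀ e, (ρ e * t (T.proj.onE e)) • D.base (T.proj.onV (T.term e)) = T.term e :=
      fun e => by
    conv_rhs => rw [← hρ e]
    rw [← T.smul_term, hLt, T.proj.onV_term, mul_smul]
  have hfix : ∀ {g h : G} {v : T.V}, g • D.base (T.proj.onV v) = v →
      h • D.base (T.proj.onV v) = v → g⁻¹ * h ∈ D.vertexSubgroup (T.proj.onV v) :=
    fun {g h v} hg hh => hmem.2 (by rw [mul_smul, hh, inv_smul_eq_iff, hg])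
  -- Edge-freeness enters here: the element carrying `L` to a given edge is unique, so both
  -- orientations are compatible.
  have hρb : ∀ e, ρ (T.bar e) = ρ e * t (T.proj.onE e) := fun e => by
    refine hT.eq_of_smul_eq (e := L (T.proj.onE (T.bar e))) ?_
    rw [hρ, T.proj.onE_bar, hLb, mul_smul, smul_inv_smul, T.smul_bar, hρ]
  -- The function `Ψ` sought has the form `F (g • base x) * ι x (s⁻¹ * g)`. This `c` is the
  -- increment of `F` across `e` that makes passing from `ρ e` to `ρ e * t` multiply `Ψ` by `τ`.
  let c : T.E → K := fun e =>
    ι (T.proj.onV (T.init e)) ((s (T.init e))⁻¹ * ρ e) * τ (T.proj.onE e) *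
      ι (T.proj.onV (T.term e)) ((ρ e * t (T.proj.onE e))⁻¹ * s (T.term e))
  obtain ⟨F, hF⟩ := T.isTree.exists_potential (c := c) (fun e => by
    have h₁ : T.init (T.bar e) = T.term e := rfl
    simp only [c, h₁, T.term_bar, hρb, T.proj.onE_bar, hτb, htb, mul_inv_cancel_right,
      mul_inv_rev (_ * _) (ι _ _), mul_inv_rev (ι _ _)]
    rw [← hιinv (hfix (hs _) (hρi e)), ← hιinv (hfix (hρt e) (hs _))]
    simp [mul_assoc])
  let Ψ : T.quot.V → G → K := fun x g => F (g • D.base x) * ι x ((s (g • D.base x))⁻¹ * g)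
  have hproj : ∀ x (g : G), T.proj.onV (g • D.base x) = x := fun x g => by
    rw [proj_smul, D.proj_base]
  have hsb : ∀ x (g : G), (s (g • D.base x))⁻¹ * g ∈ D.vertexSubgroup x := fun x g => by
    have := hfix (v := g • D.base x) (hs _) (by rw [hproj])
    rwa [hproj] at this
  have hΨι : ∀ x g h, h ∈ D.vertexSubgroup x → Ψ x (g * h) = Ψ x g * ι x h := by
    intro x g h hh
    have hb : h • D.base x = D.base x := hh
    simp only [Ψ, mul_smul, hb]
    rw [← mul_assoc, hιmul (hsb x g) hh, mul_assoc]
  have hΨt : ∀ e g, Ψ (T.quot.term e) (g * t e) = Ψ (T.quot.init e) g * τ e := by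
    intro e g
    have hpe : T.proj.onE (g • L e) = e := by rw [proj_smul_edge, hL]
    have hρg : ρ (g • L e) = g := hT.eq_of_smul_eq (e := L e) (by
      have := hρ (g • L e)
      rwa [hpe] at this)
    have hi : T.init (g • L e) = g • D.base (T.quot.init e) := by rw [← T.smul_init, hLi]
    have ht' : T.term (g • L e) = (g * t e) • D.base (T.quot.term e) := by
      rw [← T.smul_term, hLt, mul_smul]
    have h := hF (g • L e)
    simp only [c, hi, ht', hρg, hpe, hproj] at h
    have hinv := hιinv (hsb (T.quot.term e) (g * t e))
    rw [mul_inv_rev, inv_inv] at hinv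
    simp only [Ψ]
    rw [h, hinv]
    simp [mul_assoc]
  -- Both `t` and `τ` are trivial on the maximal tree, so moving along it does not change `Ψ`.
  have hΨ : ∀ g x, Ψ x g = Ψ x₀ g := by
    intro g x
    refine hmaxTree.induction (P := fun x => Ψ x.1 g = Ψ x₀ g) (v₀ := ⟨x₀, hx₀⟩) rfl ?_
      ⟨x, D.spanning x⟩
    intro e he
    have := hΨt e.1 g
    rw [ht₁ e.1 e.2, hτ₁ e.1 e.2, mul_one, mul_one] at this
    exact this.trans he
  -- `Ψ` is, up to normalisation, the required homomorphism
  have hhom : ∀ h, ∃ k, ∀ g, Ψ x₀ (g * h) = Ψ x₀ g * k := by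
    let M : Subgroup G :=
      { carrier := {h | ∃ k, ∀ g, Ψ x₀ (g * h) = Ψ x₀ g * k}
        one_mem' := ⟨1, by simp⟩
        mul_mem' := by
          rintro a b ⟨k, hk⟩ ⟨l, hl⟩
          exact ⟨k * l, fun g => by rw [← mul_assoc, hl, hk, mul_assoc]⟩
        inv_mem' := by
          rintro a ⟨k, hk⟩
          exact ⟨k⁻¹, fun g => by rw [eq_mul_inv_iff_mul_eq, ← hk, inv_mul_cancel_right]⟩ }
    have : M = ⊤ := hgen M
      (fun x h hh => ⟨ι x h, fun g => by rw [← hΨ _ x, ← hΨ _ x, hΨι x g h hh]⟩)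
      (fun e => ⟨τ e, fun g => by rw [← hΨ _ (T.quot.term e), hΨt, hΨ]⟩)
    intro h
    exact (this ▸ Subgroup.mem_top h : h ∈ M)
  choose φ hφ using hhom
  -- `Ψ x₀ 1` need not be 1, so values of `φ` are compared after cancelling it.
  have huniq : ∀ h k, Ψ x₀ (1 * h) = Ψ x₀ 1 * k → φ h = k := fun h k hk => by
    rw [hφ] at hk
    exact mul_left_cancel hk
  refine ⟨MonoidHom.mk' φ fun a b => huniq _ _ ?_, fun x b => huniq _ _ ?_, fun e => huniq _ _ ?_⟩
  · rw [← mul_assoc, hφ, hφ, mul_assoc]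
  · rw [← hι x b, ← hΨ _ x, ← hΨ _ x, hΨι x 1 b b.2]
  · rw [← hτy, ← hΨ _ (T.quot.term e.1), hΨt, hΨ]

/-- The structure theorem for cocompact edge-free trees. -/
theorem TreeLift.exists_isInternalFreeProduct (D : T.TreeLift) (hT : T.IsEdgeFree)
    (hc : T.IsCocompact) : ∃ (r : ℕ) (x : Fin r → G), IsInternalFreeProduct D.vertexSubgroup x := by
  obtain ⟨P, hP⟩ := T.quot.exists_orientation
  obtain ⟨x, hx⟩ := D.isInternalFreeProduct hT hP
  have := hc.2
  exact ⟨_, _, hx.reindex (Finite.equivFin _).symm⟩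

end GTree

/-! ### Existence of representative trees; superfluous vertices -/

namespace SerreGraph

theorem IsConnected.map {X Y : SerreGraph.{u}} (hX : X.IsConnected) (f : Hom X Y)
    (hf : Function.Surjective f.onV) : Y.IsConnected := by
  obtain ⟨v⟩ := hX.1
  refine isConnected_of_forall_isPath (f.onV v) fun w => ?_
  obtain ⟨w, rfl⟩ := hf w
  obtain ⟨l, hl⟩ := hX.2 v w
  exact ⟨_, f.isPath _ _ _ hl⟩

/-- The inclusion of full subgraphs. -/
def fullSubgraphMono (Y : SerreGraph.{u}) {S S' : Set Y.V} (h : S ⊆ S') :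
    Hom (Y.fullSubgraph S).toGraph (Y.fullSubgraph S').toGraph where
  onV v := ⟨v.1, h v.2⟩
  onE e := ⟨e.1, h e.2.1, h e.2.2⟩
  onE_bar _ := rfl
  onV_init _ := rfl

theorem fullSubgraph_insert_isConnected {Y : SerreGraph.{u}} {S : Set Y.V}
    (hS : (Y.fullSubgraph S).toGraph.IsConnected) {e : Y.E} (he : Y.init e ∈ S) :
    (Y.fullSubgraph (insert (Y.term e) S)).toGraph.IsConnected := by
  have hsub := Set.subset_insert (Y.term e) S
  have hS' := hS.2 ⟨_, he⟩
  refine isConnected_of_forall_isPath ⟨Y.init e, hsub he⟩ ?_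
  rintro ⟨v, rfl | hv⟩
  · exact ⟨[⟨e, hsub he, Set.mem_insert _ _⟩], rfl, rfl⟩
  · obtain ⟨l, hl⟩ := hS' ⟨v, hv⟩
    exact ⟨_, (Y.fullSubgraphMono hsub).isPath _ _ _ hl⟩

end SerreGraph

namespace GTree

variable {G : Type u} [Group G] {T : GTree G}

/-- A connected set of representatives of the vertex orbits spans a representative tree. -/
theorem exists_treeLift_of_connected {S : Set T.V} (hS : (T.fullSubgraph S).toGraph.IsConnected)
    (hinj : Set.InjOn T.proj.onV S) (hsurj : ∀ x, ∃ v ∈ S, T.proj.onV v = x) :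
    ∃ D : T.TreeLift, D.j.range.verts = S := by
  -- An edge of a tree is determined by its endpoints, so injectivity on vertices gives injectivity
  -- on edges.
  have hE : ∀ e ∈ (T.fullSubgraph S).edges, ∀ f ∈ (T.fullSubgraph S).edges,
      T.proj.onE e = T.proj.onE f → e = f := by
    intro e he f hf h
    refine T.isTree.edge_eq (hinj he.1 hf.1 ?_) (hinj he.2 hf.2 ?_)
    · rw [T.proj.onV_init, T.proj.onV_init, h]
    · rw [T.proj.onV_term, T.proj.onV_term, h]
  let M : SerreGraph.Subgraph T.quot :=
    { verts := Set.univ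
      edges := T.proj.onE '' (T.fullSubgraph S).edges
      bar_mem := by
        rintro _ ⟨e, he, rfl⟩
        exact ⟨T.bar e, (T.fullSubgraph S).bar_mem e he, T.proj.onE_bar e⟩
      init_mem := fun _ _ => Set.mem_univ _ }
  choose v hvS hv using hsurj
  choose f hfS hf using fun e : M.toGraph.E => e.2
  let j : SerreGraph.Hom M.toGraph T.toSerreGraph :=
    { onV := fun x => v x.1
      onE := f
      onE_bar := fun e => hE _ (hfS _) _ ((T.fullSubgraph S).bar_mem _ (hfS e)) (by
        rw [hf, T.proj.onE_bar, hf]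
        rfl)
      onV_init := fun e => hinj (hvS _) (hfS e).1 (by
        rw [hv, T.proj.onV_init, hf]
        rfl) }
  have hj : Function.Injective j.onE := fun e e' h => Subtype.ext (by
    rw [← hf e, ← hf e']
    exact congrArg T.proj.onE h)
  let p : SerreGraph.Hom (T.fullSubgraph S).toGraph M.toGraph :=
    { onV := fun w => ⟨T.proj.onV w.1, Set.mem_univ _⟩
      onE := fun e => ⟨T.proj.onE e.1, e.1, e.2, rfl⟩
      onE_bar := fun _ => rfl
      onV_init := fun _ => rfl }
  have hp : Function.Surjective p.onV := fun x => ⟨⟨v x.1, hvS _⟩, Subtype.ext (hv x.1)⟩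
  refine ⟨⟨M, T.isTree.of_hom (hS.map p hp) j hj, fun x => Set.mem_univ x, j, fun x => hv x.1,
    fun e => hf e⟩, ?_⟩
  ext w
  constructor
  · rintro ⟨x, rfl⟩
    exact hvS x.1
  · intro hw
    exact ⟨⟨T.proj.onV w, Set.mem_univ _⟩, hinj (hvS _) hw (hv _)⟩

/-- Take a connected set of inequivalent vertices whose image is maximal, which exists because the
quotient has finitely many vertices. If an orbit were missed, some edge of `T` would leave the set
towards a new orbit, and its endpoint could be added. -/
theorem IsCocompact.nonempty_treeLift (hT : T.IsCocompact) : Nonempty T.TreeLift := by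
  have := hT.1
  let 𝒜 : Set (Set T.quot.V) := {A | ∃ S : Set T.V, (T.fullSubgraph S).toGraph.IsConnected ∧
    Set.InjOn T.proj.onV S ∧ T.proj.onV '' S = A}
  obtain ⟨v₀⟩ := T.isTree.1
  have h𝒜 : 𝒜.Nonempty := by
    refine ⟨_, {v₀}, SerreGraph.isConnected_of_forall_isPath ⟨v₀, rfl⟩ ?_,
      Set.injOn_singleton _ _, rfl⟩
    rintro ⟨v, rfl⟩
    exact ⟨[], rfl⟩
  obtain ⟨A, ⟨S, hS, hinj, rfl⟩, hmax⟩ := (Set.toFinite 𝒜).exists_maximal h𝒜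
  obtain ⟨⟨s, hs⟩⟩ := hS.1
  have hsurj : ∀ x, x ∈ T.proj.onV '' S := by
    refine T.quot_isConnected.induction (v₀ := T.proj.onV s) ⟨s, hs, rfl⟩ fun e he => ?_
    obtain ⟨w, hw, hwe⟩ := he
    obtain ⟨f, rfl, rfl⟩ := exists_edge_at hwe
    by_contra h
    rw [← T.proj.onV_term] at h
    have hmem : T.proj.onV '' insert (T.term f) S ∈ 𝒜 :=
      ⟨_, SerreGraph.fullSubgraph_insert_isConnected hS hw,
        (Set.injOn_insert fun h' => h ⟨_, h', rfl⟩).2 ⟨hinj, h⟩, rfl⟩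
    exact h (hmax hmem (Set.image_mono (Set.subset_insert _ _))
      ⟨_, Set.mem_insert _ _, rfl⟩)
  obtain ⟨D, -⟩ := exists_treeLift_of_connected hS hinj hsurj
  exact ⟨D⟩

theorem IsSuperfluous.smul {v : T.V} (hv : T.IsSuperfluous v) (g : G) :
    T.IsSuperfluous (g • v) := by
  refine ⟨?_, fun h hh e he => ?_⟩
  · have : {e : T.E | T.init e = g • v} = (g • ·) '' {e : T.E | T.init e = v} := by
      ext e
      constructor
      · intro he
        refine ⟨g⁻¹ • e, ?_, smul_inv_smul g e⟩
        change T.init (g⁻¹ • e) = v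
        rw [← T.smul_init, show T.init e = g • v from he, inv_smul_smul]
      · rintro ⟨e, he, rfl⟩
        change T.init (g • e) = g • v
        rw [← T.smul_init, show T.init e = v from he]
    rw [this, (MulAction.injective g).encard_image]
    exact hv.1
  · have := hv.2 (g⁻¹ * h * g) (by rw [mul_smul, mul_smul, hh, inv_smul_smul]) (g⁻¹ • e)
      (by rw [← T.smul_init, he, inv_smul_smul])
    rw [mul_smul, mul_smul, smul_inv_smul] at this
    exact MulAction.injective _ this

theorem IsEdgeFree.stabilizer_eq_bot (hT : T.IsEdgeFree) {v : T.V} (hv : T.IsSuperfluous v) :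
    MulAction.stabilizer G v = ⊥ := by
  have : {e : T.E | T.init e = v}.Nonempty := by
    rw [← Set.encard_pos, hv.1]
    norm_num
  obtain ⟨e, he⟩ := this
  exact (Subgroup.eq_bot_iff_forall _).2 fun g hg => hT e g (Or.inl (hv.2 g hg e he))

end GTree

/-! ### The tree of a free product -/

section

variable {G : Type u} [Group G] {ι κ : Type}

/-- The index of the terminal vertex of an edge of the star with centre `c` and loops `κ`. -/
def starStop {c : ι} : {i : ι // i ≠ c} ⊕ κ → ι
  | Sum.inl i => i
  | Sum.inr _ => c

/-- The element of the group by which an edge of the star with centre `c` and loops `κ` is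
twisted. -/
def starTwist {c : ι} (x : κ → G) : {i : ι // i ≠ c} ⊕ κ → G
  | Sum.inl _ => 1
  | Sum.inr j => x j

/-- The Bass-Serre graph of the free product of the `B i` and the free group on the `x j`. The
quotient graph is a star with centre `c` and one leaf for every other index, together with a loop
at the centre for each `x j`. -/
def starGraph (B : ι → Subgroup G) (c : ι) (x : κ → G) : SerreGraph.{u} where
  V := Σ i, G ⧸ B i
  E := (G × ({i : ι // i ≠ c} ⊕ κ)) × Bool
  bar e := (e.1, !e.2)
  init e := cond e.2 ⟨c, (e.1.1 : G ⧸ B c)⟩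
    ⟨starStop e.1.2, ((e.1.1 * starTwist x e.1.2 : G) : G ⧸ B (starStop e.1.2))⟩
  bar_bar e := by simp
  bar_ne e h := by simpa using congrArg Prod.snd h

variable (B : ι → Subgroup G) (c : ι) (x : κ → G)

/-- The vertex of the star graph given by a coset. -/
def starVertex (i : ι) (g : G) : (starGraph B c x).V := ⟨i, (g : G ⧸ B i)⟩

variable {B c x}

theorem starGraph_init_false (p : G × ({i : ι // i ≠ c} ⊕ κ)) :
    (starGraph B c x).init (p, false) =
      starVertex B c x (starStop p.2) (p.1 * starTwist x p.2) := rfl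

theorem starGraph_term_false (p : G × ({i : ι // i ≠ c} ⊕ κ)) :
    (starGraph B c x).term (p, false) = starVertex B c x c p.1 := rfl

theorem starVertex_mul_of_mem {i : ι} {b : G} (hb : b ∈ B i) (g : G) :
    starVertex B c x i (g * b) = starVertex B c x i g :=
  congrArg (Sigma.mk i) (QuotientGroup.mk_mul_of_mem g hb)

theorem exists_starVertex (v : (starGraph B c x).V) : ∃ i g, v = starVertex B c x i g := by
  obtain ⟨i, v⟩ := v
  obtain ⟨g, rfl⟩ := QuotientGroup.mk_surjective v
  exact ⟨i, g, rfl⟩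

theorem exists_isPath_centre_starVertex (i : ι) (g : G) :
    ∃ l, (starGraph B c x).IsPath (starVertex B c x c g) l (starVertex B c x i g) := by
  by_cases hi : i = c
  · subst hi
    exact ⟨[], rfl⟩
  · refine ⟨[((g, Sum.inl ⟨i, hi⟩), true)], rfl, ?_⟩
    change starVertex B c x i (g * 1) = starVertex B c x i g
    rw [mul_one]

/-- The elements `a` for which the centres at `g` and `g * a` are always joined form a subgroup. It
contains `B i`, since `g` and `g * b` share a vertex over `i`, and each `x j`, by its loop edge. -/
theorem starGraph_isConnected (h : IsInternalFreeProduct B x) :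
    (starGraph B c x).IsConnected := by
  let M : Subgroup G :=
    { carrier := {a | ∀ g, ∃ l, (starGraph B c x).IsPath
        (starVertex B c x c g) l (starVertex B c x c (g * a))}
      one_mem' := fun g => ⟨[], by rw [mul_one]; rfl⟩
      mul_mem' := by
        intro a b ha hb g
        obtain ⟨l, hl⟩ := ha g
        obtain ⟨l', hl'⟩ := hb (g * a)
        rw [mul_assoc] at hl'
        exact ⟨_, hl.append hl'⟩
      inv_mem' := by
        intro a ha g
        obtain ⟨l, hl⟩ := ha (g * a⁻¹)
        rw [inv_mul_cancel_right] at hl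
        exact ⟨_, hl.reverse⟩ }
  have hM : M = ⊤ := by
    refine h.generate M (fun i b hb g => ?_) fun j g => ?_
    · obtain ⟨l, hl⟩ := exists_isPath_centre_starVertex (B := B) (c := c) (x := x) i g
      obtain ⟨l', hl'⟩ := exists_isPath_centre_starVertex (B := B) (c := c) (x := x) i (g * b)
      rw [starVertex_mul_of_mem hb] at hl'
      exact ⟨_, hl.append hl'.reverse⟩
    · exact ⟨[((g, Sum.inr j), true)], rfl, rfl⟩
  refine SerreGraph.isConnected_of_forall_isPath (starVertex B c x c 1) fun v => ?_
  obtain ⟨i, g, rfl⟩ := exists_starVertex v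
  obtain ⟨l, hl⟩ := (hM ▸ Subgroup.mem_top g : g ∈ M) 1
  obtain ⟨l', hl'⟩ := exists_isPath_centre_starVertex (B := B) (c := c) (x := x) i g
  rw [one_mul] at hl
  exact ⟨_, hl.append hl'⟩

/-- The free group on the positive edges of the star graph. -/
abbrev StarLabels (G : Type u) (c : ι) (κ : Type) : Type u :=
  FreeGroup (G × ({i : ι // i ≠ c} ⊕ κ))

/-- The universal property of the free product yields a potential for the tautological cocycle
with values in the free group on the positive edges. -/
theorem exists_starPotential (h : IsInternalFreeProduct B x) :
    ∃ F : (starGraph B c x).V → StarLabels G c κ,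
      ∀ e, F ((starGraph B c x).term e) = F ((starGraph B c x).init e) * FreeGroup.mk [e] := by
  classical
  let q : ι → G → StarLabels G c κ := fun i g =>
    if hi : i = c then 1 else FreeGroup.of (g, Sum.inl ⟨i, hi⟩)
  -- Homomorphisms to this semidirect product over the identity of `G` are crossed homomorphisms. On
  -- `B i` the coboundary of `q i` is prescribed, on `x j` the label of the loop edge; the inverses
  -- come from the left action on functions.
  obtain ⟨φ, hφB, hφx⟩ := h.extend (SemidirectProduct (G → StarLabels G c κ) G mulAutArrow)
    (fun i => (MulAut.conj (SemidirectProduct.inl fun g => q i g⁻¹)).toMonoidHom.comp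
      (SemidirectProduct.inr.comp (B i).subtype))
    (fun j => SemidirectProduct.inl (fun g => FreeGroup.of (g⁻¹, Sum.inr j)) *
      SemidirectProduct.inr (x j))
  have hright : ∀ g, (φ g).right = g := by
    let M : Subgroup G := MonoidHom.eqLocus (SemidirectProduct.rightHom.comp φ) (MonoidHom.id G)
    have hM : M = ⊤ := h.generate M
      (fun i b hb => by
        change (φ b).right = b
        rw [hφB i ⟨b, hb⟩]
        simp)
      (fun j => by
        change (φ (x j)).right = x j
        rw [hφx j]
        simp)
    intro g
    exact (hM ▸ Subgroup.mem_top g : g ∈ M)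
  have hmul : ∀ a b, (φ (a * b)).left 1 = (φ a).left 1 * (φ b).left a⁻¹ := by
    intro a b
    rw [map_mul, SemidirectProduct.mul_left, hright]
    change (φ a).left 1 * (φ b).left (a⁻¹ • 1) = _
    rw [smul_eq_mul, mul_one]
  have hB : ∀ i b g, b ∈ B i → (φ b).left g⁻¹ = q i g * (q i (g * b))⁻¹ := by
    intro i b g hb
    have h₁ : φ b = SemidirectProduct.inl (fun g => q i g⁻¹) * SemidirectProduct.inr b *
      (SemidirectProduct.inl fun g => q i g⁻¹)⁻¹ := hφB i ⟨b, hb⟩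
    rw [h₁, ← map_inv, SemidirectProduct.mul_left, SemidirectProduct.mul_left]
    simp only [SemidirectProduct.mul_right, SemidirectProduct.left_inl,
      SemidirectProduct.right_inl, SemidirectProduct.left_inr, SemidirectProduct.right_inr,
      map_one, one_mul, mul_one]
    change q i g⁻¹⁻¹ * (q i (b⁻¹ * g⁻¹)⁻¹)⁻¹ = _
    rw [mul_inv_rev, inv_inv, inv_inv]
  have hx : ∀ j g, (φ (x j)).left g⁻¹ = FreeGroup.of (g, Sum.inr j) := by
    intro j g
    rw [hφx j, SemidirectProduct.mul_left]
    simp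
  -- The factor `q v.1 g` cancels the coboundary on `B i`, making the value depend only on the
  -- coset.
  let F : (starGraph B c x).V → StarLabels G c κ := fun v =>
    Quotient.liftOn' v.2 (fun g => (φ g).left 1 * q v.1 g) (by
      intro a b hab
      rw [QuotientGroup.leftRel_apply] at hab
      have h₁ := hmul a (a⁻¹ * b)
      rw [hB _ _ a hab, mul_inv_cancel_left] at h₁
      change (φ a).left 1 * q v.1 a = (φ b).left 1 * q v.1 b
      rw [h₁]
      simp [mul_assoc])
  have hF : ∀ i g, F (starVertex B c x i g) = (φ g).left 1 * q i g := fun i g => rfl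
  have key : ∀ p : G × ({i : ι // i ≠ c} ⊕ κ),
      F (starVertex B c x (starStop p.2) (p.1 * starTwist x p.2)) =
        F (starVertex B c x c p.1) * FreeGroup.of p := by
    rintro ⟨g, i | j⟩
    · rw [hF, hF]
      simp [starTwist, starStop, q, i.2]
    · rw [hF, hF]
      change (φ (g * x j)).left 1 * q c (g * x j) = (φ g).left 1 * q c g * _
      rw [hmul, hx]
      simp [q]
  refine ⟨F, ?_⟩
  rintro ⟨p, b⟩
  cases b
  · rw [starGraph_init_false, starGraph_term_false, key, mul_assoc]
    change _ = _ * (FreeGroup.mk [(p, true)] * FreeGroup.mk [(p, false)])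
    rw [show FreeGroup.mk [(p, false)] = (FreeGroup.mk [(p, true)])⁻¹ by
      simp [FreeGroup.inv_mk, FreeGroup.invRev], mul_inv_cancel, mul_one]
  · exact key p

/-- An oriented edge is literally a letter of the free group, so a reduced path is a reduced word.
The potential determines the group element of that word from the endpoints, hence the path. -/
theorem starGraph_isTree (h : IsInternalFreeProduct B x) : (starGraph B c x).IsTree := by
  classical
  have hconn := starGraph_isConnected (c := c) h
  refine ⟨hconn.1, fun v w => ?_⟩
  obtain ⟨F, hF⟩ := exists_starPotential (c := c) h
  have hpath : ∀ (l : List (starGraph B c x).E) (v w : (starGraph B c x).V),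
      (starGraph B c x).IsPath v l w → F w = F v * FreeGroup.mk l := by
    intro l
    induction l with
    | nil =>
      rintro v w rfl
      exact (mul_one _).symm
    | cons e l ih =>
      rintro v w ⟨rfl, hl⟩
      rw [ih _ _ hl, hF, mul_assoc]
      rfl
  have hred : ∀ l : List (starGraph B c x).E, (starGraph B c x).IsReduced l →
      FreeGroup.IsReduced l := by
    intro l hl
    refine List.IsChain.imp (fun a b hab h₁ => ?_) hl
    by_contra h₂
    exact hab (Prod.ext h₁.symm (Bool.eq_not_of_ne (Ne.symm h₂)))
  obtain ⟨l, hl, hr⟩ := hconn.exists_isReduced v w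
  refine ⟨l, ⟨hl, hr⟩, fun l' h' => ?_⟩
  have := (hpath _ _ _ h'.1).symm.trans (hpath _ _ _ hl)
  have : FreeGroup.reduce l' = FreeGroup.reduce l :=
    congrArg FreeGroup.toWord (mul_left_cancel this)
  exact (hred _ h'.2).reduce_eq.symm.trans (this.trans (hred _ hr).reduce_eq)

end

section

variable {G : Type u} [Group G] {ι κ : Type} {B : ι → Subgroup G} {x : κ → G}

/-- The Bass-Serre tree of a free product, with all edges of length one. -/
def starTree (h : IsInternalFreeProduct B x) (c : ι) : GTree G where
  toSerreGraph := starGraph B c x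
  isTree := starGraph_isTree h
  len _ := 1
  len_pos _ := one_pos
  len_bar _ := rfl
  len_bdd _ := ⟨1, one_pos, fun _ _ => le_rfl⟩
  actV := inferInstanceAs (MulAction G (Σ i, G ⧸ B i))
  actE :=
    { smul := fun g e => ((g * e.1.1, e.1.2), e.2)
      one_smul := fun e => Prod.ext (Prod.ext (one_mul _) rfl) rfl
      mul_smul := fun g h e => Prod.ext (Prod.ext (mul_assoc g h _) rfl) rfl }
  smul_bar _ _ := rfl
  smul_init := by
    rintro g ⟨⟨a, i⟩, b⟩
    cases b
    · exact congrArg (Sigma.mk (starStop i))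
        (congrArg (QuotientGroup.mk (s := B (starStop i))) (mul_assoc g a _).symm)
    · rfl
  len_smul _ _ := rfl
  no_inversion := by
    rintro g ⟨p, b⟩ h
    have h' : b = !b := congrArg Prod.snd h
    simp at h'

/-! ### Properties of the star tree -/

namespace StarTree

variable (h : IsInternalFreeProduct B x) (c : ι)

/-- The vertex of the tree given by a coset. -/
def vertex (i : ι) (g : G) : (starTree h c).V := starVertex B c x i g

/-- The edge of the tree over a positive edge of the star. -/
def edge (g : G) (p : {i : ι // i ≠ c} ⊕ κ) : (starTree h c).E := ((g, p), true)

theorem exists_vertex (v : (starTree h c).V) : ∃ i g, v = vertex h c i g := exists_starVertex v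

theorem exists_edge (e : (starTree h c).E) :
    ∃ g p, e = edge h c g p ∨ e = (starTree h c).bar (edge h c g p) := by
  obtain ⟨⟨g, p⟩, b⟩ := e
  cases b
  · exact ⟨g, p, Or.inr rfl⟩
  · exact ⟨g, p, Or.inl rfl⟩

theorem term_edge_inl (g : G) (i : {i : ι // i ≠ c}) :
    (starTree h c).term (edge h c g (Sum.inl i)) = vertex h c i g :=
  congrArg (vertex h c i) (mul_one g)

theorem smul_vertex (i : ι) (g a : G) : g • vertex h c i a = vertex h c i (g * a) := rfl

theorem vertex_mul_of_mem {i : ι} {b : G} (hb : b ∈ B i) (g : G) :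
    vertex h c i (g * b) = vertex h c i g := starVertex_mul_of_mem hb g

theorem stabilizer_vertex (i : ι) : MulAction.stabilizer G (vertex h c i 1) = B i := by
  ext g
  rw [MulAction.mem_stabilizer_iff, smul_vertex, mul_one]
  constructor
  · intro hg
    have : (QuotientGroup.mk g : G ⧸ B i) = QuotientGroup.mk 1 :=
      eq_of_heq (Sigma.mk.inj hg).2
    rw [eq_comm, QuotientGroup.eq] at this
    simpa using this
  · intro hg
    simpa using vertex_mul_of_mem h c hg 1

theorem conj_mem_stabilizer {i : ι} {b : G} (hb : b ∈ B i) (g : G) :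
    (g * b * g⁻¹) • vertex h c i g = vertex h c i g := by
  rw [smul_vertex, inv_mul_cancel_right, vertex_mul_of_mem h c hb]

theorem isEdgeFree : (starTree h c).IsEdgeFree := by
  rintro ⟨⟨a, p⟩, b⟩ g (hg | hg)
  · have : g * a = a := congrArg (fun e => e.1.1) hg
    simpa using this
  · exact absurd hg ((starTree h c).no_inversion g _)

theorem isCocompact [Finite ι] [Finite κ] : (starTree h c).IsCocompact := by
  constructor
  · refine Finite.of_surjective (fun i : ι => (starTree h c).proj.onV (vertex h c i 1)) fun v => ?_
    obtain ⟨v, rfl⟩ := GTree.proj_surjective v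
    obtain ⟨i, g, rfl⟩ := exists_vertex h c v
    refine ⟨i, ?_⟩
    simp only
    rw [← GTree.proj_smul g, smul_vertex, mul_one]
  · refine Finite.of_surjective (fun p : ({i : ι // i ≠ c} ⊕ κ) × Bool =>
      (starTree h c).proj.onE ((1, p.1), p.2)) fun e => ?_
    obtain ⟨⟨⟨g, p⟩, b⟩, rfl⟩ := GTree.proj_edge_surjective e
    refine ⟨(p, b), ?_⟩
    refine (GTree.proj_smul_edge g _).symm.trans ?_
    exact congrArg (fun a => (starTree h c).proj.onE ((a, p), b)) (mul_one g)

/-- A superfluous vertex has trivial stabiliser, so it lies over the centre and `B c = ⊥`. Then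
there are no leaves, all vertices form one orbit, and all are superfluous. -/
theorem isStandard (hB : ∀ i, i ≠ c → B i ≠ ⊥) (hc : B c = ⊥ → ∀ i, i = c) :
    (starTree h c).IsStandard := by
  rintro ⟨v, hv⟩ w
  obtain ⟨i, g, rfl⟩ := exists_vertex h c v
  have hv₁ := hv.smul g⁻¹
  rw [smul_vertex, inv_mul_cancel] at hv₁
  have hi : B i = ⊥ := by
    rw [← stabilizer_vertex h c i]
    exact (isEdgeFree h c).stabilizer_eq_bot hv₁
  have hic : i = c := by
    by_contra h'
    exact hB i h' hi
  subst hic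
  obtain ⟨j, a, rfl⟩ := exists_vertex h i w
  cases hc hi j
  have := hv₁.smul a
  rwa [smul_vertex, mul_one] at this

/-- An invariant subtree contains one centre, hence all of them, and every edge lies on a reduced
path between two centres. -/
theorem isMinimal (hB : ∀ i, i ≠ c → B i ≠ ⊥) (hc : B c = ⊥ → ∀ i, i = c) :
    (starTree h c).IsMinimal := by
  intro S hS hV hE
  have hcentre : ∃ g, vertex h c c g ∈ S.verts := by
    by_contra! hno
    obtain ⟨⟨v, hv⟩⟩ := hS.1
    obtain ⟨i, g, rfl⟩ := exists_vertex h c v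
    have hic : i ≠ c := by
      rintro rfl
      exact hno g hv
    -- Every edge has an end over the centre, so a subtree avoiding centres is a single vertex,
    -- fixed by `G`. A nontrivial conjugate of an element of `B c` would then fix two vertices.
    have hall : ∀ w : S.toGraph.V, w.1 = vertex h c i g := by
      refine hS.induction (P := fun w => w.1 = vertex h c i g) (v₀ := ⟨_, hv⟩) rfl ?_
      rintro ⟨e, he⟩ -
      obtain ⟨a, p, rfl | rfl⟩ := exists_edge h c e
      · exact absurd (S.init_mem _ he) (hno a)
      · have := S.term_mem he
        rw [SerreGraph.term_bar] at this
        exact absurd this (hno a)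
    obtain ⟨a, ha, ha₁⟩ := (B c).bot_or_exists_ne_one.resolve_left fun h' => hic (hc h' i)
    refine hic ?_
    have hne : g * a * g⁻¹ ≠ 1 := by
      intro h'
      exact ha₁ (by simpa using h')
    have := (isEdgeFree h c).eq_of_fixed hne (hall ⟨_, hV (g * a * g⁻¹) _ hv⟩)
      (conj_mem_stabilizer h c ha g)
    exact congrArg Sigma.fst this
  obtain ⟨g₀, hg₀⟩ := hcentre
  have hcentres : ∀ g, vertex h c c g ∈ S.verts := fun g => by
    have := hV (g * g₀⁻¹) _ hg₀
    rwa [smul_vertex, inv_mul_cancel_right] at this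
  have hedges : ∀ g p, edge h c g p ∈ S.edges := by
    rintro g (i | j)
    · obtain ⟨b, hb, hb₁⟩ := (B i).bot_or_exists_ne_one.resolve_left (hB i i.2)
      -- The centres at `g` and `g * b` are joined through their common leaf over `i`; the path does
      -- not backtrack because `b ≠ 1`.
      refine (starTree h c).isTree.mem_edges_of_isPath hS (hcentres g) (hcentres (g * b))
        (l := [edge h c g (Sum.inl i), (starTree h c).bar (edge h c (g * b) (Sum.inl i))])
        ⟨rfl, ?_, ?_⟩ (List.isChain_cons_cons.2 ⟨fun h' => hb₁ ?_,
          List.isChain_singleton _⟩) List.mem_cons_self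
      · rw [term_edge_inl, ← vertex_mul_of_mem h c hb g, ← term_edge_inl]
        rfl
      · rw [SerreGraph.term_bar]
        rfl
      · have h'' : g * b = g := congrArg (fun e => e.1.1) h'
        simpa using h''
    · exact (starTree h c).isTree.mem_edges_of_isPath hS (hcentres g) (hcentres (g * x j))
        (SerreGraph.isPath_singleton _) (List.isChain_singleton _) List.mem_cons_self
  constructor
  · refine Set.eq_univ_of_forall fun v => ?_
    obtain ⟨i, g, rfl⟩ := exists_vertex h c v
    by_cases hi : i = c
    · subst hi
      exact hcentres g
    · rw [← term_edge_inl h c g ⟨i, hi⟩]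
      exact S.term_mem (hedges g _)
  · refine Set.eq_univ_of_forall fun e => ?_
    obtain ⟨g, p, rfl | rfl⟩ := exists_edge h c e
    · exact hedges g p
    · exact S.bar_mem _ (hedges g p)

theorem exists_treeLift :
    ∃ D : (starTree h c).TreeLift, D.j.range.verts = Set.range fun i => vertex h c i 1 := by
  refine GTree.exists_treeLift_of_connected ?_ ?_ ?_
  · refine SerreGraph.isConnected_of_forall_isPath ⟨vertex h c c 1, c, rfl⟩ ?_
    rintro ⟨_, i, rfl⟩
    by_cases hi : i = c
    · subst hi
      exact ⟨[], rfl⟩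
    · have ht := term_edge_inl h c 1 ⟨i, hi⟩
      exact ⟨[⟨edge h c 1 (Sum.inl ⟨i, hi⟩), ⟨c, rfl⟩, i, ht.symm⟩], rfl, Subtype.ext ht⟩
  · rintro _ ⟨i, rfl⟩ _ ⟨j, rfl⟩ hij
    obtain ⟨g, hg⟩ := GTree.exists_smul_of_proj_eq hij
    have : j = i := congrArg Sigma.fst hg
    rw [this]
  · intro v
    obtain ⟨v, rfl⟩ := GTree.proj_surjective v
    obtain ⟨i, g, rfl⟩ := exists_vertex h c v
    refine ⟨_, ⟨i, rfl⟩, ?_⟩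
    simp only
    rw [← GTree.proj_smul g, smul_vertex, mul_one]

end StarTree

theorem exists_tree_of_isInternalFreeProduct {k r : ℕ} {H : Fin k → Subgroup G}
    (hH : ∀ i, H i ≠ ⊥) {x : Fin r → G} (h : IsInternalFreeProduct H x) :
    ∃ T : GTree G, T.IsStandard ∧ T.IsMinimal ∧ T.IsCocompact ∧ T.IsEdgeFree ∧
      ∃ T₀, T.IsRepresentativeTree T₀ ∧ StabilisersAreExactly T T₀ H := by
  cases k with
  | zero =>
    -- With no factor available as centre, a trivial one is added; the star becomes a rose with one
    -- vertex.
    have h' : IsInternalFreeProduct (fun _ : Unit => (⊥ : Subgroup G)) x :=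
      IsInternalFreeProduct.of_comp (σ := fun i : Fin 0 => ()) (by convert h) fun _ _ => rfl
    have h₁ : ∀ i : Unit, i ≠ () → (⊥ : Subgroup G) ≠ ⊥ := fun i hi => absurd rfl hi
    have h₂ : (⊥ : Subgroup G) = ⊥ → ∀ i : Unit, i = () := fun _ _ => rfl
    obtain ⟨D, hD⟩ := StarTree.exists_treeLift h' ()
    refine ⟨starTree h' (), StarTree.isStandard h' () h₁ h₂, StarTree.isMinimal h' () h₁ h₂,
      StarTree.isCocompact h' (), StarTree.isEdgeFree h' (), D.j.range, ⟨D, rfl⟩, ?_⟩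
    have : IsEmpty {v : (starTree h' ()).V // v ∈ D.j.range.verts ∧
        MulAction.stabilizer G v ≠ ⊥} := by
      refine ⟨fun v => ?_⟩
      obtain ⟨v, hv, hv'⟩ := v
      rw [hD] at hv
      obtain ⟨i, rfl⟩ := hv
      exact hv' (StarTree.stabilizer_vertex h' () i)
    exact ⟨Equiv.equivOfIsEmpty _ _, fun i => i.elim0⟩
  | succ k =>
    have h₁ : ∀ i, i ≠ 0 → H i ≠ ⊥ := fun i _ => hH i
    have h₂ : H 0 = ⊥ → ∀ i : Fin (k + 1), i = 0 := fun h' => absurd h' (hH 0)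
    obtain ⟨D, hD⟩ := StarTree.exists_treeLift h 0
    refine ⟨starTree h 0, StarTree.isStandard h 0 h₁ h₂, StarTree.isMinimal h 0 h₁ h₂,
      StarTree.isCocompact h 0, StarTree.isEdgeFree h 0, D.j.range, ⟨D, rfl⟩, ?_⟩
    refine ⟨Equiv.ofBijective (fun i => ⟨StarTree.vertex h 0 i 1, by rw [hD]; exact ⟨i, rfl⟩, by
      rw [StarTree.stabilizer_vertex]; exact hH i⟩) ⟨fun i j hij => ?_, ?_⟩, fun i => ?_⟩
    · exact congrArg (fun v => v.1.1) hij
    · rintro ⟨v, hv, hv'⟩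
      have hv₁ := hv
      rw [hD] at hv₁
      obtain ⟨i, rfl⟩ := hv₁
      exact ⟨i, rfl⟩
    · exact (StarTree.stabilizer_vertex h 0 i).symm

end

/-! ### Vertex groups of representative trees; elliptic subgroups -/

namespace GTree

variable {G : Type u} [Group G] {T : GTree G}

theorem TreeLift.base_injective (D : T.TreeLift) : Function.Injective D.base := fun x y h => by
  rw [← D.proj_base x, h, D.proj_base]

theorem TreeLift.mem_range_verts (D : T.TreeLift) {v : T.V} :
    v ∈ D.j.range.verts ↔ ∃ x, D.base x = v :=
  ⟨fun ⟨x, hx⟩ => ⟨x.1, hx⟩, fun ⟨x, hx⟩ => ⟨⟨x, D.spanning x⟩, hx⟩⟩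

theorem TreeLift.exists_smul_base (D : T.TreeLift) (v : T.V) :
    ∃ (g : G) (x : T.quot.V), v = g • D.base x := by
  obtain ⟨g, hg⟩ := exists_smul_of_proj_eq (D.proj_base (T.proj.onV v)).symm
  exact ⟨g, _, hg.symm⟩

/-- The nontrivial vertex groups of the quotient graph of groups correspond to the nontrivial
vertex stabilisers in the representative tree. -/
noncomputable def TreeLift.nontrivialEquiv (D : T.TreeLift) (hT : T.IsEdgeFree) :
    {x : (D.quotientGraphOfGroups hT).graph.V //
      Nontrivial ((D.quotientGraphOfGroups hT).vertexGroup x)} ≃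
    {v : T.V // v ∈ D.j.range.verts ∧ MulAction.stabilizer G v ≠ ⊥} :=
  Equiv.ofBijective
    (fun x => ⟨D.base x.1, D.mem_range_verts.2 ⟨_, rfl⟩, (Subgroup.nontrivial_iff_ne_bot _).1 x.2⟩)
    ⟨fun x y h => Subtype.ext (D.base_injective (congrArg Subtype.val h)), by
      rintro ⟨v, hv, hv'⟩
      obtain ⟨x, rfl⟩ := D.mem_range_verts.1 hv
      exact ⟨⟨x, (Subgroup.nontrivial_iff_ne_bot _).2 hv'⟩, rfl⟩⟩

theorem TreeLift.vertexGroupsAreExactly_iff (D : T.TreeLift) (hT : T.IsEdgeFree) {k : ℕ}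
    {H : Fin k → Subgroup G} :
    VertexGroupsAreExactly hT D H ↔ StabilisersAreExactly T D.j.range H := by
  constructor
  · rintro ⟨σ, hσ⟩
    exact ⟨σ.trans (D.nontrivialEquiv hT), hσ⟩
  · rintro ⟨σ, hσ⟩
    refine ⟨σ.trans (D.nontrivialEquiv hT).symm, fun i => ?_⟩
    rw [hσ i]
    have : D.nontrivialEquiv hT ((σ.trans (D.nontrivialEquiv hT).symm) i) = σ i := by simp
    rw [← this]
    rfl

/-- The structure theorem gives a factor for every vertex of the quotient; the trivial ones are
dropped. -/
theorem TreeLift.isFreeProductDecomposition (D : T.TreeLift) (hT : T.IsEdgeFree)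
    (hc : T.IsCocompact) {k : ℕ} {H : Fin k → Subgroup G} (hH : VertexGroupsAreExactly hT D H) :
    ∃ r, IsFreeProductDecomposition H r := by
  obtain ⟨r, x, hx⟩ := D.exists_isInternalFreeProduct hT hc
  obtain ⟨σ, hσ⟩ := hH
  refine ⟨r, (isFreeProductDecomposition_iff H r).2 ⟨x, ?_⟩⟩
  obtain rfl : H = D.vertexSubgroup ∘ fun i => (σ i).1 := funext hσ
  refine hx.comp (fun i j h => σ.injective (Subtype.ext h)) fun y hy => ?_
  by_contra h
  exact hy ⟨σ.symm ⟨y, (Subgroup.nontrivial_iff_ne_bot _).2 h⟩, by simp⟩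

theorem TreeLift.exists_stabilisersAreExactly (D : T.TreeLift) (hc : T.IsCocompact) :
    ∃ (k : ℕ) (H : Fin k → Subgroup G), StabilisersAreExactly T D.j.range H := by
  have := hc.1
  have : Finite {v : T.V // v ∈ D.j.range.verts ∧ MulAction.stabilizer G v ≠ ⊥} := by
    refine Finite.of_injective (fun v => T.proj.onV v.1) ?_
    rintro ⟨v, hv, hv'⟩ ⟨w, hw, hw'⟩ h
    obtain ⟨x, rfl⟩ := D.mem_range_verts.1 hv
    obtain ⟨y, rfl⟩ := D.mem_range_verts.1 hw
    simp only [D.proj_base] at h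
    subst h
    rfl
  exact ⟨_, _, (Finite.equivFin _).symm, fun i => rfl⟩

/-- Without inversions, fixing an interior point of an edge forces fixing the oriented edge, hence
its initial vertex. -/
theorem isElliptic_iff {H : Subgroup G} :
    T.IsElliptic H ↔ ∃ v : T.V, H ≤ MulAction.stabilizer G v := by
  constructor
  · rintro ⟨⟨v | ⟨⟨e, t⟩, ht⟩⟩, hp⟩
    · refine ⟨v, fun g hg => ?_⟩
      have h : T.pointSetoid.r (PrePoint.act g (Sum.inl v)) (Sum.inl v) := Quotient.exact (hp g hg)
      rcases h with h | h <;> exact (Sum.inl_injective h).symm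
    · refine ⟨T.init e, fun g hg => ?_⟩
      have h : T.pointSetoid.r (PrePoint.act g (Sum.inr ⟨(e, t), ht⟩)) (Sum.inr ⟨(e, t), ht⟩) :=
        Quotient.exact (hp g hg)
      rw [MulAction.mem_stabilizer_iff, T.smul_init]
      rcases h with h | h
      · have : e = g • e := congrArg (fun p => p.1.1) (Sum.inr_injective h)
        rw [← this]
      · have : e = T.bar (g • e) := congrArg (fun p => p.1.1) (Sum.inr_injective h)
        exact absurd (by rw [this, T.bar_bar]; exact congrArg _ this.symm) (T.no_inversion g e)
  · rintro ⟨v, hv⟩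
    exact ⟨Quotient.mk _ (Sum.inl v), fun g hg =>
      congrArg (fun w => Quotient.mk T.pointSetoid (Sum.inl w)) (hv hg)⟩

end GTree

/-! ### The bijection of free factor systems -/

section

variable {G : Type u} [Group G]

theorem map_conj_stabilizer {α : Type*} [MulAction G α] (g : G) (a : α) :
    (MulAction.stabilizer G a).map (MulAut.conj g).toMonoidHom = MulAction.stabilizer G (g • a) :=
  (MulAction.stabilizer_smul_eq_stabilizer_map_conj g a).symm

theorem mem_subgroupConjClass_self (H : Subgroup G) : H ∈ subgroupConjClass H :=
  ⟨1, by ext; simp⟩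

theorem subgroupConjClass_map_conj (g : G) (H : Subgroup G) :
    subgroupConjClass (H.map (MulAut.conj g).toMonoidHom) = subgroupConjClass H := by
  have key : ∀ (a b : G) (K : Subgroup G),
      (K.map (MulAut.conj b).toMonoidHom).map (MulAut.conj a).toMonoidHom =
        K.map (MulAut.conj (a * b)).toMonoidHom := fun a b K => by
    rw [Subgroup.map_map]
    congr 1
    ext y
    simp [mul_assoc]
  ext K
  constructor
  · rintro ⟨a, rfl⟩
    exact ⟨a * g, key a g H⟩
  · rintro ⟨a, rfl⟩
    exact ⟨a * g⁻¹, by rw [key, inv_mul_cancel_right]⟩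

/-- The conjugacy classes of the maximal nontrivial members of a set of subgroups. -/
def maximalClasses (𝒢 : Set (Subgroup G)) : Set (Set (Subgroup G)) :=
  {C | ∃ K, K ≠ ⊥ ∧ Maximal (· ∈ 𝒢) K ∧ C = subgroupConjClass K}

/-- The subgroups which are trivial or contained in a member of one of the given classes. -/
def subordinateSubgroups (𝒞 : Set (Set (Subgroup G))) : Set (Subgroup G) :=
  {H | H = ⊥ ∨ ∃ C ∈ 𝒞, ∃ K ∈ C, H ≤ K}

namespace GTree

variable {T : GTree G}

/-- In an edge-free tree, the nontrivial vertex stabilisers are the maximal nontrivial elliptic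
subgroups. -/
theorem IsEdgeFree.maximal_iff (hT : T.IsEdgeFree) {K : Subgroup G} (hK : K ≠ ⊥) :
    Maximal (· ∈ T.ellipticSubgroups) K ↔ ∃ v : T.V, K = MulAction.stabilizer G v := by
  constructor
  · rintro ⟨hK', hmax⟩
    obtain ⟨v, hv⟩ := isElliptic_iff.1 hK'
    exact ⟨v, le_antisymm hv (hmax (isElliptic_iff.2 ⟨v, le_rfl⟩) hv)⟩
  · rintro ⟨v, rfl⟩
    refine ⟨isElliptic_iff.2 ⟨v, le_rfl⟩, fun L hL hle => ?_⟩
    obtain ⟨w, hw⟩ := isElliptic_iff.1 hL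
    -- A nontrivial `g` fixing both `v` and `w` forces `v = w`.
    obtain ⟨g, hg, hg₁⟩ := (MulAction.stabilizer G v).bot_or_exists_ne_one.resolve_left hK
    have : v = w := hT.eq_of_fixed hg₁ hg (hw (hle hg))
    rwa [← this] at hw

theorem TreeLift.maximalClasses_eq (D : T.TreeLift) (hT : T.IsEdgeFree) :
    maximalClasses T.ellipticSubgroups = {C | ∃ v ∈ D.j.range.verts,
      MulAction.stabilizer G v ≠ ⊥ ∧ C = subgroupConjClass (MulAction.stabilizer G v)} := by
  ext C
  constructor
  · rintro ⟨K, hK, hmax, rfl⟩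
    obtain ⟨v, rfl⟩ := (hT.maximal_iff hK).1 hmax
    obtain ⟨g, x, rfl⟩ := D.exists_smul_base v
    rw [← map_conj_stabilizer] at hK ⊢
    exact ⟨_, D.mem_range_verts.2 ⟨x, rfl⟩, fun h => hK (by rw [h, Subgroup.map_bot]),
      subgroupConjClass_map_conj _ _⟩
  · rintro ⟨v, -, hv, rfl⟩
    exact ⟨_, hv, (hT.maximal_iff hv).2 ⟨v, rfl⟩, rfl⟩

/-- Conjugates of vertex stabilisers are vertex stabilisers, and each nontrivial elliptic subgroup
lies in one. The trivial subgroup is treated separately, since a free action has no maximal classes.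
-/
theorem IsEdgeFree.subordinateSubgroups_maximalClasses (hT : T.IsEdgeFree) :
    subordinateSubgroups (maximalClasses T.ellipticSubgroups) = T.ellipticSubgroups := by
  ext H
  constructor
  · rintro (rfl | ⟨_, ⟨K, hK, hmax, rfl⟩, _, ⟨g, rfl⟩, hle⟩)
    · obtain ⟨v⟩ := T.isTree.1
      exact isElliptic_iff.2 ⟨v, bot_le⟩
    · obtain ⟨v, rfl⟩ := (hT.maximal_iff hK).1 hmax
      rw [map_conj_stabilizer] at hle
      exact isElliptic_iff.2 ⟨_, hle⟩
  · intro hH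
    by_cases h : H = ⊥
    · exact Or.inl h
    · obtain ⟨v, hv⟩ := isElliptic_iff.1 hH
      have hv' : MulAction.stabilizer G v ≠ ⊥ := fun h' => h (le_bot_iff.1 (h' ▸ hv))
      exact Or.inr ⟨_, ⟨_, hv', (hT.maximal_iff hv').2 ⟨v, rfl⟩, rfl⟩, _,
        mem_subgroupConjClass_self _, hv⟩

end GTree

theorem StabilisersAreExactly.range_subgroupConjClass {T : GTree G}
    {T₀ : SerreGraph.Subgraph T.toSerreGraph} {k : ℕ} {H : Fin k → Subgroup G}
    (h : StabilisersAreExactly T T₀ H) :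
    (Set.range fun i => subgroupConjClass (H i)) = {C | ∃ v ∈ T₀.verts,
      MulAction.stabilizer G v ≠ ⊥ ∧ C = subgroupConjClass (MulAction.stabilizer G v)} := by
  obtain ⟨σ, hσ⟩ := h
  ext C
  constructor
  · rintro ⟨i, rfl⟩
    exact ⟨_, (σ i).2.1, (σ i).2.2, congrArg subgroupConjClass (hσ i)⟩
  · rintro ⟨v, hv, hv', rfl⟩
    refine ⟨σ.symm ⟨v, hv, hv'⟩, ?_⟩
    simp [hσ]

theorem StabilisersAreExactly.ne_bot {T : GTree G} {T₀ : SerreGraph.Subgraph T.toSerreGraph}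
    {k : ℕ} {H : Fin k → Subgroup G} (h : StabilisersAreExactly T T₀ H) (i : Fin k) : H i ≠ ⊥ := by
  obtain ⟨σ, hσ⟩ := h
  rw [hσ]
  exact (σ i).2.2

/-- The right side involves neither a tree nor a lift, which is the independence of choices;
`IsCocompact.nonempty_treeLift` shows that a choice exists. -/
theorem yieldsTraditional_iff {𝒢 : Set (Subgroup G)} (h𝒢 : IsFreeFactorSystem 𝒢)
    (𝒞 : Set (Set (Subgroup G))) : YieldsTraditional 𝒢 𝒞 ↔ 𝒞 = maximalClasses 𝒢 := by
  constructor
  · rintro ⟨T, -, -, -, hT, rfl, _, ⟨D, rfl⟩, rfl⟩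
    exact (D.maximalClasses_eq hT).symm
  · rintro rfl
    obtain ⟨T, hs, hm, hc, hT, rfl⟩ := h𝒢
    obtain ⟨D⟩ := hc.nonempty_treeLift
    exact ⟨T, hs, hm, hc, hT, rfl, _, ⟨D, rfl⟩, D.maximalClasses_eq hT⟩

/-- Independence of choices in the other direction: the last equation expresses the result through
the classes alone. -/
theorem YieldsFreeFactorSystem.eq_maximalClasses {𝒞 : Set (Set (Subgroup G))}
    {𝒢 : Set (Subgroup G)} (h : YieldsFreeFactorSystem 𝒞 𝒢) :
    IsFreeFactorSystem 𝒢 ∧ 𝒞 = maximalClasses 𝒢 ∧ 𝒢 = subordinateSubgroups 𝒞 := by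
  obtain ⟨k, r, H, -, -, rfl, T, hs, hm, hc, hT, ⟨_, ⟨D, rfl⟩, hH⟩, rfl⟩ := h
  have h := hH.range_subgroupConjClass.trans (D.maximalClasses_eq hT).symm
  exact ⟨⟨T, hs, hm, hc, hT, rfl⟩, h, by rw [h, hT.subordinateSubgroups_maximalClasses]⟩

theorem IsTraditionalFreeFactorSystem.exists_yields {𝒞 : Set (Set (Subgroup G))}
    (h : IsTraditionalFreeFactorSystem 𝒞) : ∃ 𝒢, YieldsFreeFactorSystem 𝒞 𝒢 := by
  obtain ⟨k, r, H, hH, hr, rfl⟩ := h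
  obtain ⟨x, hx⟩ := (isFreeProductDecomposition_iff H r).1 hr
  obtain ⟨T, hs, hm, hc, hT, hT₀⟩ := exists_tree_of_isInternalFreeProduct hH hx
  exact ⟨_, k, r, H, hH, hr, rfl, T, hs, hm, hc, hT, hT₀, rfl⟩

theorem IsFreeFactorSystem.isTraditional {𝒢 : Set (Subgroup G)} (h : IsFreeFactorSystem 𝒢) :
    IsTraditionalFreeFactorSystem (maximalClasses 𝒢) := by
  obtain ⟨T, -, -, hc, hT, rfl⟩ := h
  obtain ⟨D⟩ := hc.nonempty_treeLift
  obtain ⟨k, H, hH⟩ := D.exists_stabilisersAreExactly hc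
  obtain ⟨r, hr⟩ := D.isFreeProductDecomposition hT hc ((D.vertexGroupsAreExactly_iff hT).2 hH)
  exact ⟨k, r, H, hH.ne_bot, hr, by rw [D.maximalClasses_eq hT, hH.range_subgroupConjClass]⟩

theorem IsFreeFactorSystem.subordinateSubgroups_maximalClasses {𝒢 : Set (Subgroup G)}
    (h : IsFreeFactorSystem 𝒢) : subordinateSubgroups (maximalClasses 𝒢) = 𝒢 := by
  obtain ⟨T, -, -, -, hT, rfl⟩ := h
  exact hT.subordinateSubgroups_maximalClasses

/-- The bijection between free factor systems and traditional free factor systems. -/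
def freeFactorSystemEquiv (G : Type u) [Group G] :
    {𝒢 : Set (Subgroup G) // IsFreeFactorSystem 𝒢} ≃
      {𝒞 : Set (Set (Subgroup G)) // IsTraditionalFreeFactorSystem 𝒞} where
  toFun 𝒢 := ⟨maximalClasses 𝒢.1, 𝒢.2.isTraditional⟩
  invFun 𝒞 := ⟨subordinateSubgroups 𝒞.1, by
    obtain ⟨𝒢, h⟩ := 𝒞.2.exists_yields
    rw [← h.eq_maximalClasses.2.2]
    exact h.eq_maximalClasses.1⟩
  left_inv 𝒢 := Subtype.ext 𝒢.2.subordinateSubgroups_maximalClasses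
  right_inv 𝒞 := Subtype.ext (by
    obtain ⟨𝒢, h⟩ := 𝒞.2.exists_yields
    simp only
    rw [← h.eq_maximalClasses.2.2, ← h.eq_maximalClasses.2.1])

end

theorem mainTheorem7 (G : Type u) [Group G] :
    (∀ (k : ℕ) (H : Fin k → Subgroup G), (∀ i, H i ≠ ⊥) →
      List.TFAE
        [∃ T : GTree G, T.IsStandard ∧ T.IsMinimal ∧ T.IsCocompact ∧ T.IsEdgeFree ∧
            ∃ T₀, T.IsRepresentativeTree T₀ ∧ StabilisersAreExactly T T₀ H,
          ∃ T : GTree G, T.IsStandard ∧ T.IsMinimal ∧ T.IsCocompact ∧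
            ∃ (hT : T.IsEdgeFree) (D : T.TreeLift), VertexGroupsAreExactly hT D H,
          ∃ r : ℕ, IsFreeProductDecomposition H r]) ∧
    ∃ Φ : {𝒢 : Set (Subgroup G) // IsFreeFactorSystem 𝒢} ≃
        {𝒞 : Set (Set (Subgroup G)) // IsTraditionalFreeFactorSystem 𝒞},
      (∀ 𝒢 𝒞, YieldsTraditional 𝒢.1 𝒞 ↔ 𝒞 = (Φ 𝒢).1) ∧
      (∀ 𝒞 𝒢, YieldsFreeFactorSystem 𝒞.1 𝒢 ↔ 𝒢 = (Φ.symm 𝒞).1) := by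
  refine ⟨fun k H hH => ?_, freeFactorSystemEquiv G, fun 𝒢 𝒞 => yieldsTraditional_iff 𝒢.2 𝒞,
    fun 𝒞 𝒢 => ⟨fun h => h.eq_maximalClasses.2.2, ?_⟩⟩
  · tfae_have 1 → 2 := by
      rintro ⟨T, hs, hm, hc, hT, _, ⟨D, rfl⟩, h⟩
      exact ⟨T, hs, hm, hc, hT, D, (D.vertexGroupsAreExactly_iff hT).2 h⟩
    tfae_have 2 → 3 := by
      rintro ⟨T, -, -, hc, hT, D, h⟩
      exact D.isFreeProductDecomposition hT hc h
    tfae_have 3 → 1 := by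
      rintro ⟨r, hr⟩
      obtain ⟨x, hx⟩ := (isFreeProductDecomposition_iff H r).1 hr
      exact exists_tree_of_isInternalFreeProduct hH hx
    tfae_finish
  · rintro rfl
    obtain ⟨𝒢, h⟩ := 𝒞.2.exists_yields
    have h' : 𝒢 = subordinateSubgroups 𝒞.1 := h.eq_maximalClasses.2.2
    rw [h'] at h
    exact h
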